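/- **Two-time distribution of inhomogeneous exponential last passage percolation.** Let $\alpha_i,\beta_j$ $(i,j\ge 1)$ be real numbers with $\alpha_i+\beta_j>0$ for all $i,j$, and let $\omega_{i,j}$ $(i,j\ge1)$ be independent exponential random variables, $\omega_{i,j}$ having rate $\alpha_i+\beta_j$. Let $1\le m<M$ and $1\le n<N$ be integers, let $x_1\le x_2\le\cdots\le x_N$ be real numbers and let $c\le x_1$ (for example $c=0$ if $x_1\ge 0$). Define the growth function $G$ by $$G(i,j)=\max\{G(i-1,j),\,G(i,j-1)\}+\omega_{i,j}\quad(i,j\ge1),\qquad G(0,j)=x_j,\qquad G(i,0)=c\ \ (i\ge1).$$ Let $h,H$ be real numbers with $x_N\le h\le H$, and let $r>1$. Then $$\mathbb P\big(G(m,n)<h,\ G(M,N)<H\big)=\frac1{2\pi \mathbf i}\oint_{|\theta|=r}d\theta\,\frac{\det\big[\theta^{\mathbf 1\{i>n\}}L_1(i,j)-\theta^{-\mathbf 1\{i\le n\}}L_2(i,j)\big]_{i,j=1}^N}{\theta-1},$$ where $$L_1(i,j)=\frac1{(2\pi \mathbf i)^2}\oint_{|z|=R_1}dz\oint_{|w|=R_2}dw\,\frac{e^{(z-\beta_i)h+(w-\beta_j)(H-h)-x_i(z-\beta_i)}}{z-w}\,\frac{\prod_{k=1}^n(z-\beta_k)}{\prod_{k=1}^i(z-\beta_k)}\,\frac{\prod_{k=1}^{j-1}(w-\beta_k)}{\prod_{k=1}^n(w-\beta_k)}\prod_{k=1}^m\frac{\alpha_k+\beta_i}{z+\alpha_k}\prod_{k=m+1}^M\frac{\alpha_k+\beta_j}{w+\alpha_k}$$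 with $R_1>R_2>\max\{\alpha_k,\beta_j: 1\le k\le M,\ 1\le j\le N\}$, and $L_2(i,j)$ is given by the same formula but with radii (chosen independently of those of $L_1$) ordered as $R_2>R_1>\max\{\alpha_k,\beta_j: 1\le k\le M,\ 1\le j\le N\}$. All circles are centred at $0$ and oriented counter-clockwise. -/

import Mathlib

open MeasureTheory ProbabilityTheory
open scoped Real

noncomputable section

/-- The growth function `G` driven by weights `w i j` (only the indices `i, j ≥ 1` are used):
`G (i, j) = max (G (i - 1, j)) (G (i, j - 1)) + w i j`, with boundary values
`G (0, j) = x j` and `G (i, 0) = c` for `i ≥ 1`. -/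
def growth (c : ℝ) (x : ℕ → ℝ) (w : ℕ → ℕ → ℝ) : ℕ → ℕ → ℝ
  | 0, j => x j
  | _ + 1, 0 => c
  | i + 1, j + 1 => max (growth c x w i (j + 1)) (growth c x w (i + 1) j) + w (i + 1) (j + 1)

/-- The integrand of the double contour integrals; `i, j` are 1-based row and column indices. -/
def twoTimeIntegrand (α β x : ℕ → ℝ) (m n M : ℕ) (h H : ℝ) (i j : ℕ) (z w : ℂ) : ℂ :=
  Complex.exp ((z - β i) * h + (w - β j) * (H - h) - x i * (z - β i)) / (z - w)
    * ((∏ k ∈ Finset.Icc 1 n, (z - β k)) / ∏ k ∈ Finset.Icc 1 i, (z - β k))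
    * ((∏ k ∈ Finset.Icc 1 (j - 1), (w - β k)) / ∏ k ∈ Finset.Icc 1 n, (w - β k))
    * (∏ k ∈ Finset.Icc 1 m, ((α k + β i : ℂ) / (z + α k)))
    * ∏ k ∈ Finset.Icc (m + 1) M, ((α k + β j : ℂ) / (w + α k))

/-- The `N × N` matrix of double contour integrals over `|z| = R₁`, `|w| = R₂`.
The row `i : Fin N` carries the 1-based index `i + 1`, and likewise for columns. It is
`L₁` when `R₁ > R₂` and `L₂` when `R₂ > R₁`. -/
def twoTimeMatrix (α β x : ℕ → ℝ) (m n M N : ℕ) (h H R₁ R₂ : ℝ) : Matrix (Fin N) (Fin N) ℂ :=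
  Matrix.of fun i j =>
    1 / (2 * π * Complex.I) ^ 2 *
      ∮ z in C(0, R₁), ∮ w in C(0, R₂),
        twoTimeIntegrand α β x m n M h H ((i : ℕ) + 1) ((j : ℕ) + 1) z w

/-- The matrix `θ ^ 1{i > n} A(i, j) - θ ^ (-1{i ≤ n}) B(i, j)`, with 1-based row index `i`. -/
def thetaCombination (n N : ℕ) (A B : Matrix (Fin N) (Fin N) ℂ) (θ : ℂ) :
    Matrix (Fin N) (Fin N) ℂ :=
  Matrix.of fun i j =>
    (if (i : ℕ) + 1 > n then θ else 1) * A i j - (if (i : ℕ) + 1 ≤ n then θ⁻¹ else 1) * B i j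

end

/-! Read the process row by row: the state is `s = (c, G(i,1), …, G(i,N))`, which stays
nondecreasing. Conditioning on the past one cell at a time turns the probability into an iterated
integral against exponential laws (`measure_growth_lt_and_growth_lt`).

This integral is evaluated backwards. At every stage the conditional probability is `Λ(ψ₁(s₁), …,
ψ_N(s_N))`, where `Λ` is alternating multilinear and the vector `ψ_k` depends on the `k`-th
coordinate only. If `ψ_k' = κ_k (ψ_k - φ_k)` and `ψ_k'` is proportional to `ψ_{k-1}`, then a row of
weights turns `φ` into `ψ`: the coupling through the maximum only creates terms with two
proportional rows, and alternation kills them (`integral_stepRows`, `IsRowStep.rowOp_eq`). Contour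
integrals of `exp((z - β_i)(h - x))` against products of `1/(z - β_k)` and `(α_k + β_i)/(z + α_k)`
satisfy both equations; each row of weights accounts for one factor in `α`
(`hasDerivAt_contourRow_self`, `hasDerivAt_contourRow_pred`).

Between the two times `Λ` is the determinant, which starts from a unitriangular matrix at time `M`.
Before time `m`, `Λ` is `twoTimeForm`: since `θ L₁ - L₂ = (θ - 1) L₁ + (L₁ - L₂)`, the claimed
formula is an alternating form of the pairs of rows `(L₁, L₁ - L₂)`, and `L₁ - L₂` is the residue at
`z = w`, a one-time row up to diagonal conjugation.

The two forms are matched at time `m` (`twoTimeForm_twoTimeRow`). If `s n < h`, both components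
agree in the first `n` rows, so `θ ^ n` factors out of the determinant and Cauchy's formula at `θ =
1` leaves the one-time determinant. If `s n ≥ h`, the first components vanish from row `n` on, the
determinant has degree below `n` in `θ`, and the integral is zero by decay at infinity. -/

/-! ### Integrating one exponential weight out of an alternating form. -/

theorem ContinuousAlternatingMap.hasDerivAt_comp {E ι : Type*} [NormedAddCommGroup E]
    [NormedSpace ℂ E] [Fintype ι] [DecidableEq ι] (Λ : E [⋀^ι]→L[ℂ] ℂ)
    {g : ι → ℝ → E} {g' : ι → E} {y : ℝ} (hg : ∀ i, HasDerivAt (g i) (g' i) y) :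
    HasDerivAt (fun t => Λ fun i => g i t)
      (∑ i, Λ (Function.update (fun j => g j y) i (g' i))) y := by
  have := (HasFDerivAt.multilinear_comp (Λ.restrictScalars ℝ).toContinuousMultilinearMap
    fun i => (hg i).hasFDerivAt).hasDerivAt
  have hsum : ∀ F : ι → (ℝ →L[ℝ] ℂ), (∑ i, F i) 1 = ∑ i, F i 1 := fun F => by simp
  refine HasDerivAt.congr_deriv this ((hsum _).trans (Finset.sum_congr rfl fun i _ => ?_))
  simp [ContinuousMultilinearMap.toContinuousLinearMap]

/-- Integration against the exponential law, when the integrand vanishes beyond `b` and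
`-exp (-κ e) W e` is a primitive of the integrand times the exponential density. -/
theorem integral_expMeasure_eq_of_hasDerivAt {κ b : ℝ} (hκ : 0 < κ) (hb : 0 ≤ b)
    {V W : ℝ → ℂ} {S : Set ℝ} (hS : S.Countable) (hW : Continuous W) (hWb : W b = 0)
    (hV : ∀ e, b ≤ e → V e = 0) (hint : Integrable V (expMeasure κ))
    (hd : ∀ e ∈ Set.Ioo 0 b \ S, HasDerivAt W (κ * (W e - V e)) e) :
    ∫ e, V e ∂expMeasure κ = W 0 := by
  have hm : Measurable (exponentialPDF κ) :=
    (measurable_exponentialPDFReal κ).ennreal_ofReal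
  have hdef : expMeasure κ = volume.withDensity (exponentialPDF κ) := rfl
  have hfin : ∀ᵐ e : ℝ, exponentialPDF κ e < ⊤ := by simp [exponentialPDF]
  set G : ℝ → ℂ := fun e => (exponentialPDF κ e).toReal • V e with hG
  have hGint : Integrable G volume := by
    rw [hdef, integrable_withDensity_iff_integrable_smul' hm hfin] at hint
    exact hint
  rw [hdef, integral_withDensity_eq_integral_toReal_smul hm hfin]
  change ∫ e, G e = _
  have h0 : ∀ e, e ∉ Set.Ico 0 b → G e = 0 := by
    intro e he
    rcases lt_or_ge e 0 with h | h
    · simp [hG, exponentialPDF_of_neg h]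
    · have : b ≤ e := by by_contra hc; exact he ⟨h, lt_of_not_ge hc⟩
      simp [hG, hV e this]
  have h1 : ∫ e, G e = ∫ e in (0:ℝ)..b, G e := by
    rw [intervalIntegral.integral_of_le hb, ← integral_Ico_eq_integral_Ioc,
      setIntegral_eq_integral_of_forall_compl_eq_zero h0]
  have h2 := integral_eq_of_hasDerivAt_off_countable_of_le
    (fun e : ℝ => -(Complex.exp (-(κ * e : ℝ)) * W e)) G hb hS
    (Continuous.continuousOn (by fun_prop)) (fun e he => ?_) hGint.intervalIntegrable
  · rw [h1, h2]; simp [hWb]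
  · have hpos : (0:ℝ) ≤ e := he.1.1.le
    have hpdf : (exponentialPDF κ e).toReal = κ * Real.exp (-(κ * e)) := by
      rw [exponentialPDF_of_nonneg hpos, ENNReal.toReal_ofReal (by positivity)]
    have e1 : HasDerivAt (fun t : ℝ => Complex.exp (-(κ * t : ℝ)))
        (Complex.exp (-(κ * e : ℝ)) * (-κ)) e := by
      have : HasDerivAt (fun t : ℝ => (-(κ * t : ℝ) : ℂ)) (-κ : ℂ) e := by
        have := (((hasDerivAt_id e).const_mul κ).ofReal_comp).neg
        simpa [Function.comp_def, Pi.neg_def] using this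
      exact this.cexp
    refine HasDerivAt.congr_deriv (e1.mul (hd e he)).neg ?_
    simp only [hG, hpdf, Complex.real_smul]
    push_cast
    ring

/-- The rows of a determinant while row `p` is being integrated out: the rows before `p` are
frozen, row `p` is `r`, and row `k > p` is evaluated at `max (s k) y`. -/
def stepRows {E : Type*} {N : ℕ} (ψ : Fin N → ℝ → E) (p : Fin N) (b : Fin N → E) (s : Fin N → ℝ)
    (r : E) (y : ℝ) : Fin N → E :=
  fun k => if k < p then b k else if k = p then r else ψ k (max (s k) y)

/-- Integrating out one row of an alternating expression whose rows satisfy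
`ψ_p' = κ (ψ_p - φ_p)` and `ψ_k' ∈ span ψ_{k-1}`. -/
theorem integral_stepRows {E : Type*} [NormedAddCommGroup E] [NormedSpace ℂ E] {N : ℕ}
    (Λ : E [⋀^Fin N]→L[ℂ] ℂ) (φ ψ : Fin N → ℝ → E) (p : Fin N) (b : Fin N → E) (s : Fin N → ℝ)
    {κ : ℝ} (hκ : 0 < κ) (a B : ℝ) {S : Set ℝ} (hS : S.Countable)
    (hs : ∀ k l : Fin N, p < k → k ≤ l → s k ≤ s l)
    (hcont : ∀ k, p ≤ k → Continuous (ψ k))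
    (hp : ∀ y, y < B → y ∉ S → HasDerivAt (ψ p) (κ • (ψ p y - φ p y)) y)
    (hk : ∀ k l : Fin N, p ≤ l → (l : ℕ) + 1 = k → ∀ y, y < B → y ∉ S →
      ∃ c : ℂ, HasDerivAt (ψ k) (c • ψ l y) y)
    (hφ0 : ∀ y, B ≤ y → Λ (stepRows ψ p b s (φ p y) y) = 0)
    (hψ0 : ∀ y, B ≤ y → Λ (stepRows ψ p b s (ψ p y) y) = 0)
    (hint : Integrable (fun e => Λ (stepRows ψ p b s (φ p (a + e)) (a + e))) (expMeasure κ)) :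
    ∫ e, Λ (stepRows ψ p b s (φ p (a + e)) (a + e)) ∂expMeasure κ =
      Λ (stepRows ψ p b s (ψ p a) a) := by
  set W : ℝ → ℂ := fun y => Λ (stepRows ψ p b s (ψ p y) y) with hWdef
  have hWc : Continuous W := by
    refine Λ.cont.comp (continuous_pi fun k => ?_)
    unfold stepRows
    split_ifs with h1 h2
    · exact continuous_const
    · subst h2; exact hcont _ le_rfl
    · exact (hcont k (not_lt.1 h1)).comp (by fun_prop)
  -- The points `s k` are excluded because `max (s k) y` has a corner there.
  have hWd : ∀ y, y < B → y ∉ S ∪ Set.range s →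
      HasDerivAt W (κ * (W y - Λ (stepRows ψ p b s (φ p y) y))) y := by
    intro y hy hyS
    rw [Set.mem_union, not_or] at hyS
    -- Only row `p` contributes to the derivative. Earlier rows are frozen. A later row is constant
    -- while `y < s k`; once `y > s k`, its derivative is a multiple of `ψ l y` with `l = k - 1`,
    -- and this is exactly the row `l` because `s l ≤ s k < y` (or `l = p`).
    have hrow : ∀ k : Fin N, ∃ d : E,
        HasDerivAt (fun t => stepRows ψ p b s (ψ p t) t k) d y ∧
        (k = p → d = κ • (ψ p y - φ p y)) ∧
        (k ≠ p → Λ (Function.update (stepRows ψ p b s (ψ p y) y) k d) = 0) := by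
      intro k
      rcases lt_trichotomy k p with h | h | h
      · refine ⟨0, ?_, fun h' => absurd h' h.ne, fun _ => ?_⟩
        · simp only [stepRows, h, if_true]; exact hasDerivAt_const _ _
        · exact Λ.map_coord_zero k (by simp)
      · subst h
        refine ⟨κ • (ψ k y - φ k y), ?_, fun _ => rfl, fun h' => absurd rfl h'⟩
        simpa only [stepRows, lt_irrefl, if_false, if_true] using hp y hy hyS.1
      · have hne : y ≠ s k := fun h' => hyS.2 ⟨k, h'.symm⟩
        rcases lt_or_gt_of_ne hne with h3 | h3
        · refine ⟨0, ?_, fun h' => absurd h' h.ne', fun _ => Λ.map_coord_zero k (by simp)⟩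
          refine (hasDerivAt_const y (ψ k (s k))).congr_of_eventuallyEq ?_
          filter_upwards [eventually_lt_nhds h3] with t ht
          simp [stepRows, not_lt.2 h.le, h.ne', max_eq_left ht.le]
        · have hk0 : 0 < (k : ℕ) := lt_of_le_of_lt (Nat.zero_le _) h
          set l : Fin N := ⟨k - 1, by omega⟩ with hl
          have hpl : p ≤ l := by
            rw [Fin.le_def, hl]; have : (p : ℕ) < k := h; simp; omega
          have hlk : (l : ℕ) + 1 = k := by simp [hl]; omega
          have hltk : l < k := by rw [Fin.lt_def]; omega
          obtain ⟨c, hc⟩ := hk k l hpl hlk y hy hyS.1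
          refine ⟨c • ψ l y, ?_, fun h' => absurd h' h.ne', fun _ => ?_⟩
          · refine hc.congr_of_eventuallyEq ?_
            filter_upwards [eventually_gt_nhds h3] with t ht
            simp [stepRows, not_lt.2 h.le, h.ne', max_eq_right ht.le]
          · rw [Λ.map_update_smul]
            have : Λ (Function.update (stepRows ψ p b s (ψ p y) y) k (ψ l y)) = 0 := by
              refine Λ.map_eq_zero_of_eq _ (i := k) (j := l) ?_ hltk.ne'
              rw [Function.update_self, Function.update_of_ne hltk.ne]
              rcases eq_or_lt_of_le hpl with h4 | h4
              · simp [stepRows, ← h4]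
              · have : s l ≤ y := (hs l k h4 hltk.le).trans h3.le
                simp [stepRows, not_lt.2 h4.le, h4.ne', max_eq_right this]
            rw [this, smul_zero]
    choose d hd1 hd2 hd3 using hrow
    have := Λ.hasDerivAt_comp hd1
    convert this using 1
    rw [Finset.sum_eq_single p (fun k _ hkp => hd3 k hkp) (by simp), hd2 p rfl]
    have hu : ∀ r : E, Function.update (stepRows ψ p b s (ψ p y) y) p r =
        stepRows ψ p b s r y := by
      intro r
      ext k
      by_cases h : k = p
      · subst h; simp [stepRows]
      · simp [stepRows, h]
    change _ = Λ (Function.update (stepRows ψ p b s (ψ p y) y) p _)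
    have hsm : (κ • (ψ p y - φ p y) : E) = (κ : ℂ) • (ψ p y - φ p y) := by
      simp
    rw [hsm, Λ.map_update_smul, Λ.map_update_sub, hu, hu, smul_eq_mul]
  rcases le_or_gt B a with hB | hB
  · have ae0 : (fun e => Λ (stepRows ψ p b s (φ p (a + e)) (a + e))) =ᵐ[expMeasure κ] 0 := by
      have h0 : ∀ᵐ e ∂expMeasure κ, 0 ≤ e := by
        rw [ae_iff]
        simp only [not_le]
        change expMeasure κ (Set.Iio 0) = 0
        change (volume.withDensity (exponentialPDF κ)) (Set.Iio 0) = 0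
        rw [withDensity_apply _ measurableSet_Iio]
        exact lintegral_exponentialPDF_of_nonpos le_rfl
      filter_upwards [h0] with e he
      exact hφ0 _ (by linarith)
    rw [integral_congr_ae ae0, hψ0 a hB]
    simp
  · have key := integral_expMeasure_eq_of_hasDerivAt hκ (sub_nonneg.2 hB.le)
      (V := fun e => Λ (stepRows ψ p b s (φ p (a + e)) (a + e))) (W := fun e => W (a + e))
      (S := (fun e => a + e) ⁻¹' (S ∪ Set.range s))
      ((hS.union (Set.finite_range s).countable).preimage (add_right_injective a))
      (by fun_prop) (by simpa using hψ0 B le_rfl) (fun e he => hφ0 _ (by linarith)) hint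
      (fun e he => by
        have h1 : a + e < B := by linarith [he.1.2]
        simpa using (hWd (a + e) h1 he.2).comp_const_add a e)
    simpa [hWdef] using key

/-! ### The growth process as a Markov chain, cell by cell. -/

open scoped ENNReal in
/-- The transition operator of one cell: coordinate `j + 1` of the state `s` is replaced by
`max (s (j + 1)) (s j)` plus an exponential variable of rate `κ`. -/
noncomputable def cellOp (κ : ℝ) (j : ℕ) (f : (ℕ → ℝ) → ℝ≥0∞) (s : ℕ → ℝ) : ℝ≥0∞ :=
  ∫⁻ e, f (Function.update s (j + 1) (max (s (j + 1)) (s j) + e)) ∂expMeasure κ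

open scoped ENNReal in
/-- The transition operator of the first `j` cells of a row with rates `κ 1, …, κ j`. -/
noncomputable def rowOp (κ : ℕ → ℝ) : ℕ → ((ℕ → ℝ) → ℝ≥0∞) → (ℕ → ℝ) → ℝ≥0∞
  | 0, f => f
  | j + 1, f => rowOp κ j (cellOp (κ (j + 1)) j f)

open scoped ENNReal in
/-- The transition operator of the `l` rows `t + 1, …, t + l` with `N` columns. -/
noncomputable def rowsOp (α β : ℕ → ℝ) (N t : ℕ) : ℕ → ((ℕ → ℝ) → ℝ≥0∞) → (ℕ → ℝ) → ℝ≥0∞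
  | 0, f => f
  | l + 1, f => rowsOp α β N t l (rowOp (fun j => α (t + l + 1) + β j) N f)

/-- The values of the growth function along the frontier of the cells already filled, when rows
`1, …, i` and the first `j` cells of row `i + 1` are. -/
noncomputable def growthFrontier (c : ℝ) (x : ℕ → ℝ) (w : ℕ → ℕ → ℝ) (N i j : ℕ) : ℕ → ℝ := fun k =>
  if k ≤ j then growth c x w (i + 1) k else if k ≤ N then growth c x w i k else 0

theorem growthFrontier_succ (c : ℝ) (x : ℕ → ℝ) (w : ℕ → ℕ → ℝ) {N i j : ℕ} (hj : j < N) :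
    growthFrontier c x w N i (j + 1) = Function.update (growthFrontier c x w N i j) (j + 1)
      (max (growthFrontier c x w N i j (j + 1)) (growthFrontier c x w N i j j) + w (i + 1) (j + 1)) := by
  ext k
  by_cases h : k = j + 1
  · subst h
    simp [growthFrontier, growth, Nat.succ_le_of_lt hj]
  · rw [Function.update_of_ne h]
    have : k ≤ j + 1 ↔ k ≤ j := by omega
    simp [growthFrontier, this]

/-- The value `0` beyond column `N` is what makes this an equality of whole sequences: those columns
are never updated. -/
theorem growthFrontier_last (c : ℝ) (x : ℕ → ℝ) (w : ℕ → ℕ → ℝ) (N i : ℕ) :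
    growthFrontier c x w N i N = growthFrontier c x w N (i + 1) 0 := by
  ext k
  rcases Nat.eq_zero_or_pos k with rfl | hk
  · simp [growthFrontier, growth]
  · have : ¬ k ≤ 0 := by omega
    by_cases h : k ≤ N <;> simp [growthFrontier, h, this]

theorem measurable_cellOp (κ : ℝ) (hκ : 0 < κ) (j : ℕ) {f : (ℕ → ℝ) → ENNReal}
    (hf : Measurable f) : Measurable (cellOp κ j f) := by
  have := isProbabilityMeasure_expMeasure hκ
  unfold cellOp
  refine Measurable.lintegral_prod_right' (ν := expMeasure κ)
    (f := fun q : (ℕ → ℝ) × ℝ =>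
      f (Function.update q.1 (j + 1) (max (q.1 (j + 1)) (q.1 j) + q.2))) (hf.comp ?_)
  refine measurable_pi_lambda _ fun k => ?_
  by_cases h : k = j + 1
  · subst h; simp only [Function.update_self]; fun_prop
  · simp only [Function.update_of_ne h]; fun_prop

theorem measurable_rowOp {κ : ℕ → ℝ} (hκ : ∀ j, 1 ≤ j → 0 < κ j) (j : ℕ)
    {f : (ℕ → ℝ) → ENNReal} (hf : Measurable f) : Measurable (rowOp κ j f) := by
  induction j generalizing f with
  | zero => exact hf
  | succ j ih => exact ih (measurable_cellOp _ (hκ _ (by omega)) j hf)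

theorem measurable_rowsOp {α β : ℕ → ℝ} (hαβ : ∀ i j : ℕ, 1 ≤ i → 1 ≤ j → 0 < α i + β j)
    (N t l : ℕ) {f : (ℕ → ℝ) → ENNReal} (hf : Measurable f) :
    Measurable (rowsOp α β N t l f) := by
  induction l generalizing f with
  | zero => exact hf
  | succ l ih => exact ih (measurable_rowOp (fun j hj => hαβ _ _ (by omega) hj) N hf)

section Probability

variable {Ω : Type*}

/-- The sigma-algebra of the weights in rows `1, …, i` and the first `j` cells of row `i + 1`. -/
@[reducible] def pastSigma (ω : ℕ → ℕ → Ω → ℝ) (i j : ℕ) : MeasurableSpace Ω :=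
  ⨆ p ∈ {p : ℕ+ × ℕ+ | (p.1 : ℕ) ≤ i ∨ ((p.1 : ℕ) = i + 1 ∧ (p.2 : ℕ) ≤ j)},
    MeasurableSpace.comap (ω p.1 p.2) inferInstance

theorem measurable_weight_pastSigma (ω : ℕ → ℕ → Ω → ℝ) {i j a b : ℕ} (ha : 1 ≤ a) (hb : 1 ≤ b)
    (hab : a ≤ i ∨ (a = i + 1 ∧ b ≤ j)) : Measurable[pastSigma ω i j] (ω a b) := by
  refine Measurable.mono (comap_measurable (ω a b)) ?_ le_rfl
  exact le_iSup₂_of_le (f := fun (p : ℕ+ × ℕ+) _ => MeasurableSpace.comap (ω p.1 p.2) inferInstance)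
    (⟨⟨a, ha⟩, ⟨b, hb⟩⟩ : ℕ+ × ℕ+) hab le_rfl

theorem pastSigma_mono (ω : ℕ → ℕ → Ω → ℝ) {i j i' j' : ℕ} (h : i < i' ∨ (i = i' ∧ j ≤ j')) :
    pastSigma ω i j ≤ pastSigma ω i' j' := by
  refine biSup_mono fun p hp => ?_
  simp only [Set.mem_ofPred_eq] at hp ⊢
  omega

theorem measurable_growth (mΩ : MeasurableSpace Ω) (c : ℝ) (x : ℕ → ℝ) (ω : ℕ → ℕ → Ω → ℝ)
    (I K : ℕ) (hω : ∀ a b, 1 ≤ a → 1 ≤ b → a ≤ I → b ≤ K → Measurable (ω a b)) :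
    Measurable fun s => growth c x (fun i j => ω i j s) I K := by
  induction I generalizing K with
  | zero => simp only [growth]; exact measurable_const
  | succ I ihI =>
    induction K with
    | zero => simp only [growth]; exact measurable_const
    | succ K ihK =>
      simp only [growth]
      exact ((ihI (K + 1) fun a b h1 h2 h3 h4 => hω a b h1 h2 (by omega) h4).max
        (ihK fun a b h1 h2 h3 h4 => hω a b h1 h2 h3 (by omega))).add
        (hω _ _ (by omega) (by omega) le_rfl le_rfl)

theorem measurable_growthFrontier (c : ℝ) (x : ℕ → ℝ) (ω : ℕ → ℕ → Ω → ℝ) (N i j : ℕ) :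
    Measurable[pastSigma ω i j] fun s => growthFrontier c x (fun a b => ω a b s) N i j := by
  refine @measurable_pi_lambda _ _ _ (pastSigma ω i j) _ _ fun k => ?_
  unfold growthFrontier
  split_ifs with h1 h2
  · exact measurable_growth _ c x ω _ _ fun a b ha hb h3 h4 =>
      measurable_weight_pastSigma ω ha hb (by omega)
  · exact measurable_growth _ c x ω _ _ fun a b ha hb h3 h4 =>
      measurable_weight_pastSigma ω ha hb (by omega)
  · exact measurable_const

variable [mΩ : MeasurableSpace Ω] {P : Measure Ω} [IsProbabilityMeasure P]
  {α β : ℕ → ℝ} {ω : ℕ → ℕ → Ω → ℝ}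

theorem pastSigma_le (hω : ∀ i j : ℕ, 1 ≤ i → 1 ≤ j → Measurable (ω i j)) (i j : ℕ) :
    pastSigma ω i j ≤ mΩ :=
  iSup₂_le fun p _ => (hω p.1 p.2 p.1.2 p.2.2).comap_le

/-- The weight of the new cell is independent of everything filled before, so Fubini integrates it
out. The factor `Z` carries along an event already decided, later the event at the first time. -/
theorem lintegral_growthFrontier_succ (hαβ : ∀ i j : ℕ, 1 ≤ i → 1 ≤ j → 0 < α i + β j)
    (hω : ∀ i j : ℕ, 1 ≤ i → 1 ≤ j → Measurable (ω i j))
    (hlaw : ∀ i j : ℕ, 1 ≤ i → 1 ≤ j → HasLaw (ω i j) (expMeasure (α i + β j)) P)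
    (hindep : iIndepFun (fun p : ℕ+ × ℕ+ => ω p.1 p.2) P)
    (c : ℝ) (x : ℕ → ℝ) {N i j : ℕ} (hj : j < N)
    {Z : Ω → ENNReal} (hZ : Measurable[pastSigma ω i j] Z)
    {f : (ℕ → ℝ) → ENNReal} (hf : Measurable f) :
    ∫⁻ s, Z s * f (growthFrontier c x (fun a b => ω a b s) N i (j + 1)) ∂P =
      ∫⁻ s, Z s * cellOp (α (i + 1) + β (j + 1)) j f
        (growthFrontier c x (fun a b => ω a b s) N i j) ∂P := by
  have hκ := hαβ (i + 1) (j + 1) (by omega) (by omega)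
  have hY := hω (i + 1) (j + 1) (by omega) (by omega)
  have := isProbabilityMeasure_expMeasure hκ
  set X : Ω → ENNReal × (ℕ → ℝ) := fun s => (Z s, growthFrontier c x (fun a b => ω a b s) N i j)
    with hX
  have hXm : Measurable[pastSigma ω i j] X := hZ.prodMk (measurable_growthFrontier c x ω N i j)
  have hXm' : Measurable X := hXm.mono (pastSigma_le hω i j) le_rfl
  have hind : IndepFun X (ω (i + 1) (j + 1)) P := by
    rw [IndepFun_iff_Indep]
    refine indep_of_indep_of_le_left ?_ hXm.comap_le
    set q : ℕ+ × ℕ+ := ⟨⟨i + 1, by omega⟩, ⟨j + 1, by omega⟩⟩ with hq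
    have h1 := indep_iSup_of_disjoint
      (S := {p : ℕ+ × ℕ+ | (p.1 : ℕ) ≤ i ∨ ((p.1 : ℕ) = i + 1 ∧ (p.2 : ℕ) ≤ j)}) (T := {q})
      (fun p : ℕ+ × ℕ+ => (hω p.1 p.2 p.1.2 p.2.2).comap_le) hindep
      (by rw [Set.disjoint_singleton_right]; simp [hq])
    simpa [hq, pastSigma] using h1
  have hpair : P.map (fun s => (X s, ω (i + 1) (j + 1) s)) =
      (P.map X).prod (expMeasure (α (i + 1) + β (j + 1))) := by
    rw [(indepFun_iff_map_prod_eq_prod_map_map hXm'.aemeasurable hY.aemeasurable).1 hind,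
      (hlaw (i + 1) (j + 1) (by omega) (by omega)).map_eq]
  set G : (ENNReal × (ℕ → ℝ)) × ℝ → ENNReal := fun q =>
    q.1.1 * f (Function.update q.1.2 (j + 1) (max (q.1.2 (j + 1)) (q.1.2 j) + q.2)) with hG
  have hGm : Measurable G := by
    refine (measurable_fst.comp measurable_fst).mul (hf.comp ?_)
    refine measurable_pi_lambda _ fun k => ?_
    by_cases h : k = j + 1
    · subst h; simp only [Function.update_self]; fun_prop
    · simp only [Function.update_of_ne h]; fun_prop
  calc ∫⁻ s, Z s * f (growthFrontier c x (fun a b => ω a b s) N i (j + 1)) ∂P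
      = ∫⁻ s, G (X s, ω (i + 1) (j + 1) s) ∂P := by
        refine lintegral_congr fun s => ?_
        rw [growthFrontier_succ c x _ hj]
    _ = ∫⁻ q, G q ∂(P.map fun s => (X s, ω (i + 1) (j + 1) s)) :=
        (lintegral_map hGm (hXm'.prodMk hY)).symm
    _ = ∫⁻ y, ∫⁻ e, G (y, e) ∂expMeasure (α (i + 1) + β (j + 1)) ∂(P.map X) := by
        rw [hpair, lintegral_prod _ hGm.aemeasurable]
    _ = ∫⁻ s, ∫⁻ e, G (X s, e) ∂expMeasure (α (i + 1) + β (j + 1)) ∂P :=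
        lintegral_map hGm.lintegral_prod_right' hXm'
    _ = _ := by
        refine lintegral_congr fun s => ?_
        simp only [hG, hX, cellOp]
        rw [lintegral_const_mul]
        refine hf.comp (measurable_pi_lambda _ fun k => ?_)
        by_cases h : k = j + 1
        · subst h; simp only [Function.update_self]; fun_prop
        · simp only [Function.update_of_ne h]; fun_prop

theorem lintegral_growthFrontier_row (hαβ : ∀ i j : ℕ, 1 ≤ i → 1 ≤ j → 0 < α i + β j)
    (hω : ∀ i j : ℕ, 1 ≤ i → 1 ≤ j → Measurable (ω i j))
    (hlaw : ∀ i j : ℕ, 1 ≤ i → 1 ≤ j → HasLaw (ω i j) (expMeasure (α i + β j)) P)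
    (hindep : iIndepFun (fun p : ℕ+ × ℕ+ => ω p.1 p.2) P)
    (c : ℝ) (x : ℕ → ℝ) {N i j : ℕ} (hj : j ≤ N)
    {Z : Ω → ENNReal} (hZ : Measurable[pastSigma ω i 0] Z)
    {f : (ℕ → ℝ) → ENNReal} (hf : Measurable f) :
    ∫⁻ s, Z s * f (growthFrontier c x (fun a b => ω a b s) N i j) ∂P =
      ∫⁻ s, Z s * rowOp (fun k => α (i + 1) + β k) j f
        (growthFrontier c x (fun a b => ω a b s) N i 0) ∂P := by
  induction j generalizing f with
  | zero => rfl
  | succ j ih =>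
    rw [lintegral_growthFrontier_succ hαβ hω hlaw hindep c x (by omega)
      (hZ.mono (pastSigma_mono ω (Or.inr ⟨rfl, Nat.zero_le j⟩)) le_rfl) hf]
    exact ih (by omega) (measurable_cellOp _ (hαβ _ _ (by omega) (by omega)) j hf)

theorem lintegral_growthFrontier_rows (hαβ : ∀ i j : ℕ, 1 ≤ i → 1 ≤ j → 0 < α i + β j)
    (hω : ∀ i j : ℕ, 1 ≤ i → 1 ≤ j → Measurable (ω i j))
    (hlaw : ∀ i j : ℕ, 1 ≤ i → 1 ≤ j → HasLaw (ω i j) (expMeasure (α i + β j)) P)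
    (hindep : iIndepFun (fun p : ℕ+ × ℕ+ => ω p.1 p.2) P)
    (c : ℝ) (x : ℕ → ℝ) (N t l : ℕ)
    {Z : Ω → ENNReal} (hZ : Measurable[pastSigma ω t 0] Z)
    {f : (ℕ → ℝ) → ENNReal} (hf : Measurable f) :
    ∫⁻ s, Z s * f (growthFrontier c x (fun a b => ω a b s) N (t + l) 0) ∂P =
      ∫⁻ s, Z s * rowsOp α β N t l f (growthFrontier c x (fun a b => ω a b s) N t 0) ∂P := by
  induction l generalizing f with
  | zero => rfl
  | succ l ih =>
    have hZ' : Measurable[pastSigma ω (t + l) 0] Z :=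
      hZ.mono (pastSigma_mono ω (by omega)) le_rfl
    have := lintegral_growthFrontier_row hαβ hω hlaw hindep c x (le_refl N) hZ' hf
    simp only [growthFrontier_last] at this
    rw [← add_assoc, this]
    exact ih (measurable_rowOp (fun j hj => hαβ _ _ (by omega) hj) N hf)

/-- The two-time probability as an iterated integral. -/
theorem measure_growth_lt_and_growth_lt
    (hαβ : ∀ i j : ℕ, 1 ≤ i → 1 ≤ j → 0 < α i + β j)
    (hlaw : ∀ i j : ℕ, 1 ≤ i → 1 ≤ j → HasLaw (ω i j) (expMeasure (α i + β j)) P)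
    (hindep : iIndepFun (fun p : ℕ+ × ℕ+ => ω p.1 p.2) P)
    (c : ℝ) (x : ℕ → ℝ) {m n M N : ℕ} (hn : 1 ≤ n) (hmM : m ≤ M) (hnN : n ≤ N) (h H : ℝ) :
    P {s | growth c x (fun i j => ω i j s) m n < h ∧ growth c x (fun i j => ω i j s) M N < H} =
      rowsOp α β N 0 m (fun s => {s : ℕ → ℝ | s n < h}.indicator 1 s *
        rowsOp α β N m (M - m) ({s : ℕ → ℝ | s N < H}.indicator 1) s)
        (growthFrontier c x (fun _ _ => 0) N 0 0) := by
  classical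
  -- `HasLaw` only provides almost everywhere measurable weights; measurable versions are needed for
  -- the sigma-algebras of the past.
  set ω' : ℕ → ℕ → Ω → ℝ := fun i j =>
    if hij : 1 ≤ i ∧ 1 ≤ j then (hlaw i j hij.1 hij.2).aemeasurable.mk (ω i j) else ω i j with hω'
  have hae : ∀ i j, ω i j =ᵐ[P] ω' i j := by
    intro i j
    by_cases hij : 1 ≤ i ∧ 1 ≤ j
    · simp only [hω', hij, dif_pos, and_self]
      exact (hlaw i j hij.1 hij.2).aemeasurable.ae_eq_mk
    · simp only [hω', hij, dif_neg, not_false_eq_true]; rfl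
  have hm' : ∀ i j : ℕ, 1 ≤ i → 1 ≤ j → Measurable (ω' i j) := by
    intro i j hi hj
    simp only [hω', hi, hj, and_self, dif_pos]
    exact (hlaw i j hi hj).aemeasurable.measurable_mk
  have hlaw' : ∀ i j : ℕ, 1 ≤ i → 1 ≤ j → HasLaw (ω' i j) (expMeasure (α i + β j)) P :=
    fun i j hi hj => (hlaw i j hi hj).congr (hae i j).symm
  have hindep' : iIndepFun (fun p : ℕ+ × ℕ+ => ω' p.1 p.2) P :=
    hindep.congr fun p => hae p.1 p.2
  have hall : ∀ᵐ s ∂P, (fun i j => ω i j s) = fun i j => ω' i j s := by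
    have : ∀ᵐ s ∂P, ∀ i j, ω i j s = ω' i j s :=
      ae_all_iff.2 fun i => ae_all_iff.2 fun j => hae i j
    filter_upwards [this] with s hs
    ext i j
    exact hs i j
  have hcongr : P {s | growth c x (fun i j => ω i j s) m n < h ∧
      growth c x (fun i j => ω i j s) M N < H} =
      P {s | growth c x (fun i j => ω' i j s) m n < h ∧
        growth c x (fun i j => ω' i j s) M N < H} := by
    refine measure_congr ?_
    filter_upwards [hall] with s hs
    change (_ ∧ _) = (_ ∧ _)
    rw [hs]
  rw [hcongr]
  have hfr : ∀ (i k : ℕ) (s : Ω), 1 ≤ k → k ≤ N →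
      growthFrontier c x (fun a b => ω' a b s) N i 0 k = growth c x (fun a b => ω' a b s) i k := by
    intro i k s hk1 hk2
    have : ¬ k ≤ 0 := by omega
    simp [growthFrontier, this, hk2]
  set Z : Ω → ENNReal := fun s =>
    {s : ℕ → ℝ | s n < h}.indicator 1 (growthFrontier c x (fun a b => ω' a b s) N m 0) with hZ
  have hind1 : Measurable ({s : ℕ → ℝ | s n < h}.indicator (1 : (ℕ → ℝ) → ENNReal)) :=
    measurable_one.indicator (measurableSet_lt (measurable_pi_apply n) measurable_const)
  have hind2 : Measurable ({s : ℕ → ℝ | s N < H}.indicator (1 : (ℕ → ℝ) → ENNReal)) :=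
    measurable_one.indicator (measurableSet_lt (measurable_pi_apply N) measurable_const)
  have hZm : Measurable[pastSigma ω' m 0] Z := hind1.comp (measurable_growthFrontier c x ω' N m 0)
  have hgm : ∀ i k, Measurable fun s => growth c x (fun a b => ω' a b s) i k := fun i k =>
    measurable_growth _ c x ω' i k fun a b ha hb _ _ => hm' a b ha hb
  have hset : MeasurableSet {s | growth c x (fun i j => ω' i j s) m n < h ∧
      growth c x (fun i j => ω' i j s) M N < H} :=
    (measurableSet_lt (hgm m n) measurable_const).inter
      (measurableSet_lt (hgm M N) measurable_const)
  have hmul : Measurable fun s : ℕ → ℝ => {s : ℕ → ℝ | s n < h}.indicator (1 : (ℕ → ℝ) → ENNReal) s *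
      rowsOp α β N m (M - m) ({s : ℕ → ℝ | s N < H}.indicator 1) s :=
    hind1.mul (measurable_rowsOp hαβ N m (M - m) hind2)
  rw [← lintegral_indicator_one hset]
  calc ∫⁻ s, _ ∂P = ∫⁻ s, Z s * {s : ℕ → ℝ | s N < H}.indicator 1
        (growthFrontier c x (fun a b => ω' a b s) N (m + (M - m)) 0) ∂P := by
        refine lintegral_congr fun s => ?_
        have e1 := hfr m n s hn hnN
        have e2 := hfr M N s (by omega) le_rfl
        simp only [hZ, Set.indicator_apply, Set.mem_ofPred_eq, Nat.add_sub_cancel' hmM, e1, e2]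
        by_cases h1 : growth c x (fun i j => ω' i j s) m n < h <;> simp [h1]
    _ = ∫⁻ s, (1 : ENNReal) * (fun s => {s : ℕ → ℝ | s n < h}.indicator 1 s *
        rowsOp α β N m (M - m) ({s : ℕ → ℝ | s N < H}.indicator 1) s)
          (growthFrontier c x (fun a b => ω' a b s) N (0 + m) 0) ∂P := by
        rw [lintegral_growthFrontier_rows hαβ hm' hlaw' hindep' c x N m (M - m) hZm hind2]
        simp [hZ]
    _ = _ := by
        rw [lintegral_growthFrontier_rows hαβ hm' hlaw' hindep' c x N 0 m (Z := fun _ => 1)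
          measurable_const hmul]
        have : ∀ s, growthFrontier c x (fun a b => ω' a b s) N 0 0 =
            growthFrontier c x (fun _ _ => 0) N 0 0 := by
          intro s
          ext k
          rcases Nat.eq_zero_or_pos k with rfl | hk
          · simp [growthFrontier, growth]
          · have : ¬ k ≤ 0 := by omega
            simp [growthFrontier, this, growth]
        simp [this]

end Probability

/-! ### One row of weights acting on an alternating expression. -/

section Recursion

variable {E : Type*} [NormedAddCommGroup E] [NormedSpace ℂ E] {N : ℕ}

/-- The rows `φ` (after) and `ψ` (before) of an alternating expression are related by one row of
the growth process with rates `κ 1, …, κ N`. Column `p` is only integrated up to the level `B p`,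
beyond which the expression vanishes. -/
structure IsRowStep (Λ : E [⋀^Fin N]→L[ℂ] ℂ) (φ ψ : Fin N → ℝ → E) (κ : ℕ → ℝ) (B : Fin N → ℝ)
    (S : Set ℝ) : Prop where
  countable : S.Countable
  pos : ∀ j, 1 ≤ j → 0 < κ j
  cont : ∀ k, Continuous (ψ k)
  deriv_self : ∀ p y, y < B p → y ∉ S →
    HasDerivAt (ψ p) (κ ((p : ℕ) + 1) • (ψ p y - φ p y)) y
  deriv_pred : ∀ p k l : Fin N, p ≤ l → (l : ℕ) + 1 = k → ∀ y, y < B p → y ∉ S →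
    ∃ c : ℂ, HasDerivAt (ψ k) (c • ψ l y) y
  zero : ∀ (p : Fin N) (r : Fin N → E),
    (∀ k, p ≤ k → ∃ y, B p ≤ y ∧ (r k = φ k y ∨ r k = ψ k y)) → Λ r = 0

/-- The rows when the first `j` cells of the current row are filled. -/
def stateRows (φ ψ : Fin N → ℝ → E) (j : ℕ) (s : ℕ → ℝ) : Fin N → E := fun k =>
  if (k : ℕ) < j then φ k (s (k + 1)) else ψ k (max (s (k + 1)) (s j))

/-- The states that can occur when the first `j` cells of the current row are filled. -/
structure IsFrontier (N j : ℕ) (s : ℕ → ℝ) : Prop where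
  left : MonotoneOn s (Set.Icc 0 j)
  right : MonotoneOn s (Set.Icc (j + 1) N)
  zero_le : ∀ k, j + 1 ≤ k → k ≤ N → s 0 ≤ s k

theorem IsFrontier.update {j : ℕ} {s : ℕ → ℝ} (hs : IsFrontier N j s) {e : ℝ} (he : 0 ≤ e) :
    IsFrontier N (j + 1) (Function.update s (j + 1) (max (s (j + 1)) (s j) + e)) := by
  have hmax : s j ≤ max (s (j + 1)) (s j) + e := by
    have := le_max_right (s (j + 1)) (s j); linarith
  refine ⟨?_, ?_, ?_⟩
  · intro a ha b hb hab
    simp only [Set.mem_Icc] at ha hb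
    rcases eq_or_ne b (j + 1) with rfl | hb'
    · rw [Function.update_self]
      rcases eq_or_ne a (j + 1) with rfl | ha'
      · rw [Function.update_self]
      · rw [Function.update_of_ne ha']
        exact (hs.left ⟨by omega, by omega⟩ ⟨by omega, le_rfl⟩ (by omega)).trans hmax
    · rw [Function.update_of_ne hb', Function.update_of_ne (by omega)]
      exact hs.left ⟨by omega, by omega⟩ ⟨by omega, by omega⟩ hab
  · intro a ha b hb hab
    simp only [Set.mem_Icc] at ha hb
    rw [Function.update_of_ne (by omega), Function.update_of_ne (by omega)]
    exact hs.right ⟨by omega, by omega⟩ ⟨by omega, by omega⟩ hab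
  · intro k hk hkN
    rw [Function.update_of_ne (by omega), Function.update_of_ne (by omega)]
    exact hs.zero_le k (by omega) hkN

theorem ae_nonneg_expMeasure (κ : ℝ) : ∀ᵐ e ∂expMeasure κ, 0 ≤ e := by
  rw [ae_iff]
  simp only [not_le]
  change (volume.withDensity (exponentialPDF κ)) (Set.Iio 0) = 0
  rw [withDensity_apply _ measurableSet_Iio]
  exact lintegral_exponentialPDF_of_nonpos le_rfl

theorem cellOp_le_one {κ : ℝ} (hκ : 0 < κ) (j : ℕ) {f : (ℕ → ℝ) → ENNReal} (hf : ∀ s, f s ≤ 1)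
    (s : ℕ → ℝ) : cellOp κ j f s ≤ 1 := by
  have := isProbabilityMeasure_expMeasure hκ
  calc cellOp κ j f s ≤ ∫⁻ _, 1 ∂expMeasure κ := lintegral_mono fun e => hf _
    _ = 1 := by simp

theorem rowOp_le_one {κ : ℕ → ℝ} (hκ : ∀ j, 1 ≤ j → 0 < κ j) (j : ℕ) {f : (ℕ → ℝ) → ENNReal}
    (hf : ∀ s, f s ≤ 1) (s : ℕ → ℝ) : rowOp κ j f s ≤ 1 := by
  induction j generalizing f with
  | zero => exact hf s
  | succ j ih => exact ih (cellOp_le_one (hκ _ (by omega)) j hf)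

theorem rowsOp_le_one {α β : ℕ → ℝ} (hαβ : ∀ i j : ℕ, 1 ≤ i → 1 ≤ j → 0 < α i + β j) (t l : ℕ)
    {f : (ℕ → ℝ) → ENNReal} (hf : ∀ s, f s ≤ 1) (s : ℕ → ℝ) : rowsOp α β N t l f s ≤ 1 := by
  induction l generalizing f with
  | zero => exact hf s
  | succ l ih => exact ih (rowOp_le_one (fun j hj => hαβ _ _ (by omega) hj) N hf)

variable {Λ : E [⋀^Fin N]→L[ℂ] ℂ} {φ ψ : Fin N → ℝ → E} {κ : ℕ → ℝ} {B : Fin N → ℝ}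
  {S : Set ℝ}

/-- Cells are integrated out from right to left: columns to the right of the current one already
carry `ψ`, evaluated at the maximum with the current coordinate, while those to the left still carry
`φ`. This is the setting of `integral_stepRows`. -/
theorem IsRowStep.cellOp_eq (hR : IsRowStep Λ φ ψ κ B S) {j : ℕ} (hj : j < N)
    {f : (ℕ → ℝ) → ENNReal} (hf : Measurable f) (hf1 : ∀ s, f s ≤ 1)
    (hfΛ : ∀ s, IsFrontier N (j + 1) s → ((f s).toReal : ℂ) = Λ (stateRows φ ψ (j + 1) s))
    (s : ℕ → ℝ) (hs : IsFrontier N j s) :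
    ((cellOp (κ (j + 1)) j f s).toReal : ℂ) = Λ (stateRows φ ψ j s) := by
  have hκ := hR.pos (j + 1) (by omega)
  have := isProbabilityMeasure_expMeasure hκ
  set p : Fin N := ⟨j, hj⟩ with hp
  set a := max (s (j + 1)) (s j) with ha
  set u : ℝ → ℕ → ℝ := fun e => Function.update s (j + 1) (a + e) with hu
  have hum : Measurable u := by
    refine measurable_pi_lambda _ fun k => ?_
    by_cases h : k = j + 1
    · subst h; simp only [hu, Function.update_self]; fun_prop
    · simp only [hu, Function.update_of_ne h]; fun_prop
  have hsv : ∀ k l : Fin N, p < k → k ≤ l → s (k + 1) ≤ s (l + 1) := by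
    intro k l hpk hkl
    have h1 : j < k := hpk
    have h2 : (k : ℕ) ≤ l := hkl
    have h3 := l.2
    exact hs.right ⟨by omega, by omega⟩ ⟨by omega, by omega⟩ (by omega)
  have e1 : ∀ e, stateRows φ ψ (j + 1) (u e) =
      stepRows ψ p (fun k => φ k (s (k + 1))) (fun k => s (k + 1)) (φ p (a + e)) (a + e) := by
    intro e
    ext k
    rcases lt_trichotomy (k : ℕ) j with h | h | h
    · have h1 : k < p := h
      have h2 : (k : ℕ) < j + 1 := by omega
      simp [stateRows, stepRows, h1, h2, hu, h.ne]
    · have h1 : k = p := Fin.ext h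
      subst h1
      simp [stateRows, stepRows, hu, hp]
    · have h1 : ¬ k < p := by rw [Fin.lt_def]; simp [hp]; omega
      have h2 : k ≠ p := fun h' => by rw [h'] at h; simp [hp] at h
      have h3 : ¬ (k : ℕ) < j + 1 := by omega
      have h4 : (k : ℕ) ≠ j := by omega
      simp [stateRows, stepRows, h1, h2, h3, hu, h4]
  have e2 : stateRows φ ψ j s =
      stepRows ψ p (fun k => φ k (s (k + 1))) (fun k => s (k + 1)) (ψ p a) a := by
    ext k
    rcases lt_trichotomy (k : ℕ) j with h | h | h
    · have h1 : k < p := h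
      simp [stateRows, stepRows, h1, h]
    · have h1 : k = p := Fin.ext h
      subst h1
      simp [stateRows, stepRows, hp, ha]
    · have h1 : ¬ k < p := by rw [Fin.lt_def]; simp [hp]; omega
      have h2 : k ≠ p := fun h' => by rw [h'] at h; simp [hp] at h
      have h3 : ¬ (k : ℕ) < j := by omega
      -- Monotonicity on the right lets `s (j + 1)` drop out of `max (s (k + 1)) (max (s (j + 1)) (s
      -- j))`.
      have h4 : s (j + 1) ≤ s (k + 1) := hs.right ⟨le_rfl, by omega⟩ ⟨by omega, by omega⟩ (by omega)
      simp [stateRows, stepRows, h1, h2, h3, ha, ← max_assoc, max_eq_left h4]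
  have hV : ∀ᵐ e ∂expMeasure (κ (j + 1)), ((f (u e)).toReal : ℂ) =
      Λ (stepRows ψ p (fun k => φ k (s (k + 1))) (fun k => s (k + 1)) (φ p (a + e)) (a + e)) := by
    filter_upwards [ae_nonneg_expMeasure (κ (j + 1))] with e he
    rw [← e1]
    exact hfΛ _ (hs.update he)
  have hfint : Integrable (fun e => ((f (u e)).toReal : ℂ)) (expMeasure (κ (j + 1))) := by
    refine Integrable.of_bound (C := 1)
      (Complex.measurable_ofReal.comp (hf.comp hum).ennreal_toReal).aestronglyMeasurable ?_
    refine Filter.Eventually.of_forall fun e => ?_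
    rw [Complex.norm_real, Real.norm_of_nonneg ENNReal.toReal_nonneg]
    exact ENNReal.toReal_le_of_le_ofReal zero_le_one (by simpa using hf1 _)
  have key := integral_stepRows Λ φ ψ p (fun k => φ k (s (k + 1))) (fun k => s (k + 1)) hκ a (B p)
    hR.countable hsv (fun k _ => hR.cont k) (hR.deriv_self p) (fun k l => hR.deriv_pred p k l)
    (fun y hy => hR.zero p _ fun k hk => ?_) (fun y hy => hR.zero p _ fun k hk => ?_)
    (hfint.congr hV)
  · rw [e2, ← key, ← integral_congr_ae hV, integral_complex_ofReal, integral_toReal]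
    · rfl
    · exact (hf.comp hum).aemeasurable
    · exact Filter.Eventually.of_forall fun e => (hf1 _).trans_lt (by simp)
  · rcases eq_or_ne k p with rfl | hkp
    · exact ⟨y, hy, Or.inl (by simp [stepRows])⟩
    · exact ⟨max (s (k + 1)) y, hy.trans (le_max_right _ _),
        Or.inr (by simp [stepRows, hkp, not_lt.2 hk])⟩
  · rcases eq_or_ne k p with rfl | hkp
    · exact ⟨y, hy, Or.inr (by simp [stepRows])⟩
    · exact ⟨max (s (k + 1)) y, hy.trans (le_max_right _ _),
        Or.inr (by simp [stepRows, hkp, not_lt.2 hk])⟩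

theorem IsRowStep.rowOp_eq_stateRows (hR : IsRowStep Λ φ ψ κ B S) {j : ℕ} (hj : j ≤ N)
    {f : (ℕ → ℝ) → ENNReal} (hf : Measurable f) (hf1 : ∀ s, f s ≤ 1)
    (hfΛ : ∀ s, IsFrontier N j s → ((f s).toReal : ℂ) = Λ (stateRows φ ψ j s))
    (s : ℕ → ℝ) (hs : IsFrontier N 0 s) :
    ((rowOp κ j f s).toReal : ℂ) = Λ (stateRows φ ψ 0 s) := by
  induction j generalizing f with
  | zero => exact hfΛ s hs
  | succ j ih =>
    have hκ := hR.pos (j + 1) (by omega)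
    exact ih (by omega) (measurable_cellOp _ hκ j hf) (cellOp_le_one hκ j hf1)
      (hR.cellOp_eq (by omega) hf hf1 hfΛ)

/-- The maxima disappear at both ends of the row: after `N` cells no column is left to the right,
and before the first cell `s 0` is below all other coordinates. -/
theorem IsRowStep.rowOp_eq (hR : IsRowStep Λ φ ψ κ B S)
    {f : (ℕ → ℝ) → ENNReal} (hf : Measurable f) (hf1 : ∀ s, f s ≤ 1)
    (hfΛ : ∀ s, MonotoneOn s (Set.Icc 0 N) →
      ((f s).toReal : ℂ) = Λ fun k => φ k (s ((k : ℕ) + 1)))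
    (s : ℕ → ℝ) (hs : MonotoneOn s (Set.Icc 0 N)) :
    ((rowOp κ N f s).toReal : ℂ) = Λ fun k => ψ k (s ((k : ℕ) + 1)) := by
  have hs0 : IsFrontier N 0 s :=
    ⟨fun a ha b hb _ => by
      simp only [Set.mem_Icc] at ha hb
      rw [show a = b by omega],
    hs.mono (Set.Icc_subset_Icc_left (by omega)),
    fun k hk hkN => hs ⟨le_rfl, by omega⟩ ⟨by omega, hkN⟩ (by omega)⟩
  rw [hR.rowOp_eq_stateRows le_rfl hf hf1 (fun s hs => ?_) s hs0]
  · congr 1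
    ext k
    have : s 0 ≤ s (k + 1) := hs ⟨le_rfl, by omega⟩ ⟨by omega, by omega⟩ (by omega)
    simp [stateRows, this]
  · rw [hfΛ s hs.left]
    congr 1
    ext k
    simp [stateRows]

theorem rowsOp_eq {α β : ℕ → ℝ} (hαβ : ∀ i j : ℕ, 1 ≤ i → 1 ≤ j → 0 < α i + β j)
    {ρ : ℕ → Fin N → ℝ → E} {t l : ℕ}
    (hR : ∀ u, t ≤ u → u < t + l → IsRowStep Λ (ρ (u + 1)) (ρ u) (fun j => α (u + 1) + β j) B S)
    {f : (ℕ → ℝ) → ENNReal} (hf : Measurable f) (hf1 : ∀ s, f s ≤ 1)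
    (hfΛ : ∀ s, MonotoneOn s (Set.Icc 0 N) →
      ((f s).toReal : ℂ) = Λ fun k => ρ (t + l) k (s ((k : ℕ) + 1)))
    (s : ℕ → ℝ) (hs : MonotoneOn s (Set.Icc 0 N)) :
    ((rowsOp α β N t l f s).toReal : ℂ) = Λ fun k => ρ t k (s ((k : ℕ) + 1)) := by
  induction l generalizing f with
  | zero => exact hfΛ s hs
  | succ l ih =>
    have hκ : ∀ j, 1 ≤ j → 0 < α (t + l + 1) + β j := fun j hj => hαβ _ _ (by omega) hj
    exact ih (fun u h1 h2 => hR u h1 (by omega)) (measurable_rowOp hκ N hf)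
      (rowOp_le_one hκ N hf1) ((hR (t + l) (by omega) (by omega)).rowOp_eq hf hf1 hfΛ)

end Recursion

/-! ### Contour integrals: deformation, exchange, differentiation and residues. -/

section Contour

theorem circleIntegral_radius_congr {f : ℂ → ℂ} {r R : ℝ} (hr : 0 < r) (hrR : r ≤ R)
    (hf : ∀ z, r ≤ ‖z‖ → ‖z‖ ≤ R → DifferentiableAt ℂ f z) :
    (∮ z in C(0, R), f z) = ∮ z in C(0, r), f z := by
  refine Complex.circleIntegral_eq_of_differentiable_on_annulus_off_countable hr hrR
    Set.countable_empty (fun z hz => ?_) fun z hz => ?_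
  · simp only [Set.mem_sdiff, Metric.mem_closedBall, dist_zero_right, Metric.mem_ball, not_lt] at hz
    exact (hf z hz.2 hz.1).continuousAt.continuousWithinAt
  · simp only [Set.mem_sdiff, Metric.mem_closedBall, dist_zero_right, Metric.mem_ball, not_le] at hz
    exact hf z hz.1.2.le hz.1.1.le

theorem circleIntegral_radius_congr' {f : ℂ → ℂ} {ρ r R : ℝ} (hρ : 0 ≤ ρ) (hr : ρ < r) (hR : ρ < R)
    (hf : ∀ z, ρ < ‖z‖ → DifferentiableAt ℂ f z) :
    (∮ z in C(0, R), f z) = ∮ z in C(0, r), f z := by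
  rcases le_total r R with h | h
  · exact circleIntegral_radius_congr (hρ.trans_lt hr) h fun z hz _ => hf z (hr.trans_le hz)
  · exact (circleIntegral_radius_congr (hρ.trans_lt hR) h fun z hz _ => hf z (hR.trans_le hz)).symm

theorem circleIntegral_eq_zero_of_differentiable {f : ℂ → ℂ} {R : ℝ} (hR : 0 ≤ R)
    (hf : ∀ z, ‖z‖ ≤ R → DifferentiableAt ℂ f z) : (∮ z in C(0, R), f z) = 0 := by
  refine Complex.circleIntegral_eq_zero_of_differentiable_on_off_countable hR Set.countable_empty
    (fun z hz => ?_) fun z hz => ?_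
  · exact (hf z (by simpa using hz)).continuousAt.continuousWithinAt
  · exact hf z (by simpa using (Metric.ball_subset_closedBall hz.1))

/-- A contour integral over a large circle vanishes if the integrand is analytic outside and decays
faster than `1 / z`. -/
theorem circleIntegral_eq_zero_of_decay {f : ℂ → ℂ} {R : ℝ} (hR : 0 < R)
    (hf : ∀ z, R ≤ ‖z‖ → DifferentiableAt ℂ f z)
    (hlim : Filter.Tendsto (fun z => z * f z) (Bornology.cobounded ℂ) (nhds 0)) :
    (∮ z in C(0, R), f z) = 0 := by
  rw [← norm_le_zero_iff]
  refine le_of_forall_pos_le_add fun ε hε => ?_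
  have h1 := (Metric.tendsto_nhds.1 hlim) (ε / (2 * π)) (by positivity)
  rw [← comap_norm_atTop, Filter.eventually_comap] at h1
  obtain ⟨T, hT⟩ := Filter.eventually_atTop.1 h1
  set R' := max R T with hR'
  have hR'pos : 0 < R' := hR.trans_le (le_max_left _ _)
  rw [← circleIntegral_radius_congr hR (le_max_left R T) fun z hz _ => hf z hz, zero_add]
  have h2 : ∀ z ∈ Metric.sphere (0 : ℂ) R', ‖f z‖ ≤ ε / (2 * π) / R' := by
    intro z hz
    have hz' : ‖z‖ = R' := by simpa using hz
    have := hT R' (le_max_right _ _) z hz'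
    rw [dist_zero_right, norm_mul, hz'] at this
    rw [le_div_iff₀ hR'pos, mul_comm]
    exact this.le
  refine (circleIntegral.norm_integral_le_of_norm_le_const hR'pos.le h2).trans_eq ?_
  field_simp

theorem circleIntegral_swap {f : ℂ → ℂ → ℂ} {R₁ R₂ : ℝ}
    (hf : ContinuousOn (fun p : ℂ × ℂ => f p.1 p.2)
      (Metric.sphere 0 |R₁| ×ˢ Metric.sphere 0 |R₂|)) :
    (∮ z in C(0, R₁), ∮ w in C(0, R₂), f z w) = ∮ w in C(0, R₂), ∮ z in C(0, R₁), f z w := by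
  simp only [circleIntegral, smul_eq_mul]
  have hc : Continuous fun p : ℝ × ℝ => deriv (circleMap 0 R₁) p.1 *
      (deriv (circleMap 0 R₂) p.2 * f (circleMap 0 R₁ p.1) (circleMap 0 R₂ p.2)) := by
    have h1 : Continuous fun p : ℝ × ℝ => f (circleMap 0 R₁ p.1) (circleMap 0 R₂ p.2) := by
      refine hf.comp_continuous (f := fun p : ℝ × ℝ => (circleMap 0 R₁ p.1, circleMap 0 R₂ p.2))
        (by fun_prop) fun p => ?_
      exact ⟨circleMap_mem_sphere' _ _ _, circleMap_mem_sphere' _ _ _⟩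
    simp only [deriv_circleMap]
    exact Continuous.mul (by fun_prop) (Continuous.mul (by fun_prop) h1)
  simp only [← intervalIntegral.integral_const_mul]
  rw [intervalIntegral_intervalIntegral_swap]
  · refine intervalIntegral.integral_congr fun y _ => intervalIntegral.integral_congr fun x _ => ?_
    ring
  · refine (hc.continuousOn.integrableOn_compact
      (isCompact_uIcc.prod isCompact_uIcc)).mono_set (Set.prod_mono Set.uIoc_subset_uIcc
      Set.uIoc_subset_uIcc)

theorem hasDerivAt_circleIntegral_exp {K : ℂ → ℂ} {R : ℝ} (hK : ContinuousOn K (Metric.sphere 0 |R|))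
    (b : ℂ) (h x : ℝ) :
    HasDerivAt (fun x : ℝ => ∮ z in C(0, R), Complex.exp ((z - b) * (h - x)) * K z)
      (∮ z in C(0, R), -(z - b) * (Complex.exp ((z - b) * (h - x)) * K z)) x := by
  have hKc : Continuous fun θ => K (circleMap 0 R θ) :=
    hK.comp_continuous (by fun_prop) fun θ => circleMap_mem_sphere' _ _ _
  simp only [circleIntegral, smul_eq_mul, deriv_circleMap]
  -- Dominating function for `y` in the unit ball around `x`, where `|h - y| ≤ |h - x| + 1`.
  set G : ℝ → ℝ := fun θ => ‖circleMap 0 R θ * Complex.I‖ * (‖circleMap 0 R θ - b‖ *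
    (Real.exp (‖circleMap 0 R θ - b‖ * (|h - x| + 1)) * ‖K (circleMap 0 R θ)‖)) with hG
  have hc : ∀ y : ℝ, Continuous fun θ => circleMap 0 R θ * Complex.I *
      (Complex.exp ((circleMap 0 R θ - b) * (h - y)) * K (circleMap 0 R θ)) := by
    intro y
    exact Continuous.mul (by fun_prop) (Continuous.mul (by fun_prop) hKc)
  have hc' : Continuous fun θ => circleMap 0 R θ * Complex.I * (-(circleMap 0 R θ - b) *
      (Complex.exp ((circleMap 0 R θ - b) * (h - x)) * K (circleMap 0 R θ))) :=
    Continuous.mul (by fun_prop) (Continuous.mul (by fun_prop)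
      (Continuous.mul (by fun_prop) hKc))
  refine (intervalIntegral.hasDerivAt_integral_of_dominated_loc_of_deriv_le
    (F' := fun (y : ℝ) θ => circleMap 0 R θ * Complex.I * (-(circleMap 0 R θ - b) *
      (Complex.exp ((circleMap 0 R θ - b) * (h - y)) * K (circleMap 0 R θ))))
    (bound := G) (s := Metric.ball x 1) (Metric.ball_mem_nhds x one_pos)
    (Filter.Eventually.of_forall fun y => (hc y).aestronglyMeasurable)
    ((hc x).intervalIntegrable _ _) hc'.aestronglyMeasurable ?_ ?_ ?_).2
  · refine Filter.Eventually.of_forall fun θ _ y hy => ?_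
    rw [norm_mul, norm_mul (-(circleMap 0 R θ - b)), norm_mul (Complex.exp _), norm_neg]
    simp only [hG]
    gcongr
    refine (Complex.norm_exp_le_exp_norm _).trans ?_
    gcongr
    rw [norm_mul]
    gcongr
    rw [← Complex.ofReal_sub, Complex.norm_real, Real.norm_eq_abs]
    have h1 : |y - x| < 1 := by simpa [Real.dist_eq] using hy
    have h2 : h - y = (h - x) - (y - x) := by ring
    rw [h2]
    exact (abs_sub _ _).trans (by linarith)
  · refine Continuous.intervalIntegrable ?_ _ _
    exact Continuous.mul (by fun_prop) (Continuous.mul (by fun_prop)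
      (Continuous.mul (by fun_prop) hKc.norm))
  · refine Filter.Eventually.of_forall fun θ _ y _ => ?_
    have h1 : HasDerivAt (fun y : ℝ => (circleMap 0 R θ - b) * ((h : ℂ) - y))
        (-(circleMap 0 R θ - b)) y := by
      have := (((hasDerivAt_id y).ofReal_comp).const_sub (h : ℂ)).const_mul (circleMap 0 R θ - b)
      refine HasDerivAt.congr_deriv this (by simp)
    refine ((h1.cexp.mul_const (K (circleMap 0 R θ))).const_mul _).congr_deriv (by ring)

theorem continuousOn_circleIntegral_right {f : ℂ → ℂ → ℂ} {s : Set ℂ} {R : ℝ}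
    (hf : ContinuousOn (fun p : ℂ × ℂ => f p.1 p.2) (s ×ˢ Metric.sphere 0 |R|)) :
    ContinuousOn (fun z => ∮ w in C(0, R), f z w) s := by
  simp only [circleIntegral, smul_eq_mul]
  rw [continuousOn_iff_continuous_domRestrict]
  refine intervalIntegral.continuous_parametric_intervalIntegral_of_continuous' ?_ _ _
  simp only [Function.uncurry_def, deriv_circleMap]
  have : Continuous fun p : s × ℝ => f p.1 (circleMap 0 R p.2) :=
    hf.comp_continuous (f := fun p : s × ℝ => ((p.1 : ℂ), circleMap 0 R p.2)) (by fun_prop)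
      fun p => ⟨p.1.2, circleMap_mem_sphere' _ _ _⟩
  exact Continuous.mul (by fun_prop) this

theorem continuousOn_cauchyKernel {A B : ℂ → ℂ} {ρ R₁ R₂ : ℝ} (hρ : 0 ≤ ρ) (h₁ : ρ < R₁)
    (h₂ : ρ < R₂) (hne : R₁ ≠ R₂) (hA : ∀ z, ρ < ‖z‖ → ContinuousAt A z)
    (hB : ∀ z, ρ < ‖z‖ → ContinuousAt B z) :
    ContinuousOn (fun p : ℂ × ℂ => A p.1 * B p.2 / (p.1 - p.2))
      (Metric.sphere 0 |R₁| ×ˢ Metric.sphere 0 |R₂|) := by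
  rw [abs_of_pos (hρ.trans_lt h₁), abs_of_pos (hρ.trans_lt h₂)]
  rintro ⟨z, w⟩ ⟨hz, hw⟩
  simp only [mem_sphere_zero_iff_norm] at hz hw
  refine ContinuousAt.continuousWithinAt ?_
  have e1 : ContinuousAt (fun p : ℂ × ℂ => A p.1) (z, w) :=
    ContinuousAt.comp (f := Prod.fst) (hA z (hz ▸ h₁)) continuousAt_fst
  have e2 : ContinuousAt (fun p : ℂ × ℂ => B p.2) (z, w) :=
    ContinuousAt.comp (f := Prod.snd) (hB w (hw ▸ h₂)) continuousAt_snd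
  refine (e1.mul e2).div (by fun_prop) ?_
  intro h0
  have h0 : z = w := sub_eq_zero.1 h0
  rw [h0] at hz
  exact hne (hz.symm.trans hw)

/-- `A` may be singular inside the smaller circle, so Cauchy's formula on a disc does not apply
directly. The divided difference `dslope A w` has a removable singularity at `w`, so its integral is
the same over both circles; what remains is the integral of `1 / (z - w)`, equal to `2πi` outside
and `0` inside. -/
theorem circleIntegral_div_sub_sub {A : ℂ → ℂ} {r R : ℝ} {w : ℂ} (hr : 0 < r) (hrw : r < ‖w‖)
    (hwR : ‖w‖ < R) (hA : ∀ z, r ≤ ‖z‖ → DifferentiableAt ℂ A z) :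
    (∮ z in C(0, R), A z / (z - w)) - (∮ z in C(0, r), A z / (z - w)) = 2 * π * Complex.I * A w := by
  have hd : (∮ z in C(0, R), dslope A w z) = ∮ z in C(0, r), dslope A w z := by
    refine Complex.circleIntegral_eq_of_differentiable_on_annulus_off_countable hr
      (hrw.trans hwR).le (Set.countable_singleton w) (fun z hz => ?_) fun z hz => ?_
    · simp only [Set.mem_sdiff, Metric.mem_closedBall, dist_zero_right, Metric.mem_ball,
        not_lt] at hz
      refine ContinuousAt.continuousWithinAt ?_
      rcases eq_or_ne z w with rfl | h
      · exact continuousAt_dslope_same.2 (hA _ hz.2)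
      · exact (continuousAt_dslope_of_ne h).2 (hA _ hz.2).continuousAt
    · simp only [Set.mem_sdiff, Metric.mem_closedBall, dist_zero_right, Metric.mem_ball, not_le,
        Set.mem_singleton_iff] at hz
      exact (differentiableAt_dslope_of_ne hz.2).2 (hA z hz.1.2.le)
  have hsplit : ∀ T : ℝ, r ≤ T → T ≠ ‖w‖ → (∮ z in C(0, T), dslope A w z) =
      (∮ z in C(0, T), A z / (z - w)) - A w * ∮ z in C(0, T), (z - w)⁻¹ := by
    intro T hT hTw
    have hT0 : 0 ≤ T := hr.le.trans hT
    have hne : ∀ z ∈ Metric.sphere (0 : ℂ) T, z ≠ w := by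
      rintro z hz rfl
      exact hTw (by simpa using hz.symm)
    have hinv : ContinuousOn (fun z : ℂ => (z - w)⁻¹) (Metric.sphere 0 T) :=
      ContinuousOn.inv₀ (by fun_prop) fun z hz => sub_ne_zero.2 (hne z hz)
    have hAc : ContinuousOn A (Metric.sphere 0 T) := fun z hz =>
      (hA z (by rw [mem_sphere_zero_iff_norm.1 hz]; exact hT)).continuousAt.continuousWithinAt
    rw [← circleIntegral.integral_const_mul, ← circleIntegral.integral_sub]
    · refine circleIntegral.integral_congr hT0 fun z hz => ?_
      rw [dslope_of_ne _ (hne z hz), slope_def_field]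
      ring
    · simp only [div_eq_mul_inv]
      exact (hAc.mul hinv).circleIntegrable hT0
    · exact (continuousOn_const.mul hinv).circleIntegrable hT0
  rw [hsplit R (hrw.trans hwR).le hwR.ne', hsplit r le_rfl hrw.ne] at hd
  have e1 : (∮ z in C(0, R), (z - w)⁻¹) = 2 * π * Complex.I :=
    circleIntegral.integral_sub_inv_of_mem_ball (by simpa using hwR)
  have e2 : (∮ z in C(0, r), (z - w)⁻¹) = 0 := by
    refine circleIntegral_eq_zero_of_differentiable hr.le fun z hz => ?_
    refine DifferentiableAt.inv (by fun_prop) (sub_ne_zero.2 ?_)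
    rintro rfl
    exact absurd hz (not_le.2 hrw)
  rw [e1, e2] at hd
  linear_combination hd

theorem circleIntegral_circleIntegral_eq_zero {A B : ℂ → ℂ} {ρ R₁ R₂ : ℝ} (hρ : 0 ≤ ρ) (h₁ : ρ < R₁)
    (h₂ : ρ < R₂) (hne : R₁ ≠ R₂) (hA : ∀ z, ρ < ‖z‖ → ContinuousAt A z)
    (hB : ∀ z, ρ < ‖z‖ → ContinuousAt B z)
    (h0 : ∀ w, ‖w‖ = R₂ → (∮ z in C(0, R₁), A z / (z - w)) = 0) :
    (∮ z in C(0, R₁), ∮ w in C(0, R₂), A z * B w / (z - w)) = 0 := by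
  rw [circleIntegral_swap (continuousOn_cauchyKernel hρ h₁ h₂ hne hA hB)]
  have : Set.EqOn (fun w => ∮ z in C(0, R₁), A z * B w / (z - w)) (fun _ => 0)
      (Metric.sphere 0 R₂) := by
    intro w hw
    have h3 := h0 w (by simpa using hw)
    have : ∀ z, A z * B w / (z - w) = B w * (A z / (z - w)) := fun z => by ring
    simp only [this, circleIntegral.integral_const_mul, h3, mul_zero]
  rw [circleIntegral.integral_congr (hρ.trans h₂.le) this]
  simp [circleIntegral]

/-- Exchanging the order of the radii in a double contour integral with kernel `1 / (z - w)` costs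
the residue at `z = w`. -/
theorem circleIntegral_circleIntegral_sub {A B : ℂ → ℂ} {ρ R₁ R₂ R₁' R₂' R : ℝ} (hρ : 0 ≤ ρ)
    (h₂ : ρ < R₂) (h₂₁ : R₂ < R₁) (h₁' : ρ < R₁') (h₁₂' : R₁' < R₂') (hR : ρ < R)
    (hA : ∀ z, ρ < ‖z‖ → DifferentiableAt ℂ A z) (hB : ∀ z, ρ < ‖z‖ → DifferentiableAt ℂ B z) :
    (∮ z in C(0, R₁), ∮ w in C(0, R₂), A z * B w / (z - w)) -
      (∮ z in C(0, R₁'), ∮ w in C(0, R₂'), A z * B w / (z - w)) =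
      2 * π * Complex.I * ∮ w in C(0, R), A w * B w := by
  have hAc := fun z hz => (hA z hz).continuousAt
  have hBc := fun z hz => (hB z hz).continuousAt
  -- Beyond all `w`-circles: the `z`-circle of the first integral moves out to `T` without meeting
  -- `w`, then `w` moves from `R₂` to `R₂'` inside it. Both integrals then share the `w`-circle,
  -- which lies between the two `z`-circles.
  set T := max R₁ R₂' + 1 with hT
  have hT1 : R₁ < T := by have := le_max_left R₁ R₂'; linarith
  have hT2 : R₂' < T := by have := le_max_right R₁ R₂'; linarith
  have hswap : ∀ {a b : ℝ}, ρ < a → ρ < b → a ≠ b →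
      (∮ z in C(0, a), ∮ w in C(0, b), A z * B w / (z - w)) =
      ∮ w in C(0, b), ∮ z in C(0, a), A z * B w / (z - w) := fun ha hb hab =>
    circleIntegral_swap (continuousOn_cauchyKernel hρ ha hb hab hAc hBc)
  have hne : ∀ {z w : ℂ}, ‖w‖ < ‖z‖ → z - w ≠ 0 := by
    intro z w h h0
    rw [sub_eq_zero.1 h0] at h
    exact lt_irrefl _ h
  have e1 : (∮ z in C(0, R₁), ∮ w in C(0, R₂), A z * B w / (z - w)) =
      ∮ z in C(0, T), ∮ w in C(0, R₂), A z * B w / (z - w) := by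
    rw [hswap (h₂.trans h₂₁) h₂ h₂₁.ne', hswap (by linarith) h₂ (by linarith)]
    refine circleIntegral.integral_congr (by linarith) fun w hw => ?_
    have hw' : ‖w‖ = R₂ := by simpa using hw
    refine (circleIntegral_radius_congr (by linarith) hT1.le fun z hz _ => ?_).symm
    exact ((hA z (by linarith)).mul_const _).div (by fun_prop) (hne (by linarith))
  have e2 : (∮ z in C(0, T), ∮ w in C(0, R₂), A z * B w / (z - w)) =
      ∮ z in C(0, T), ∮ w in C(0, R₂'), A z * B w / (z - w) := by
    refine circleIntegral.integral_congr (by linarith) fun z hz => ?_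
    have hz' : ‖z‖ = T := by simpa using hz
    have hd : ∀ w, ρ < ‖w‖ → ‖w‖ < T → DifferentiableAt ℂ (fun w => A z * B w / (z - w)) w :=
      fun w hw1 hw2 => ((hB w hw1).const_mul _).div (by fun_prop) (hne (by linarith))
    rcases le_total R₂ R₂' with h | h
    · exact (circleIntegral_radius_congr (by linarith) h fun w hw1 hw2 =>
        hd w (by linarith) (by linarith)).symm
    · exact circleIntegral_radius_congr (by linarith) h fun w hw1 hw2 =>
        hd w (by linarith) (by linarith)
  have hint : ∀ {a b : ℝ}, ρ < a → ρ < b → a ≠ b →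
      CircleIntegrable (fun w => ∮ z in C(0, a), A z * B w / (z - w)) 0 b := by
    intro a b ha hb hab
    refine ContinuousOn.circleIntegrable (hρ.trans hb.le) ?_
    refine continuousOn_circleIntegral_right (f := fun w z => A z * B w / (z - w)) ?_
    have h3 := continuousOn_cauchyKernel hρ ha hb hab hAc hBc
    rw [abs_of_pos (hρ.trans_lt hb)] at h3
    exact ContinuousOn.comp (f := Prod.swap) (g := fun p : ℂ × ℂ => A p.1 * B p.2 / (p.1 - p.2))
      h3 continuous_swap.continuousOn fun p hp => ⟨hp.2, hp.1⟩
  rw [e1, e2, hswap (by linarith) (by linarith) hT2.ne', hswap h₁' (by linarith) h₁₂'.ne,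
    ← circleIntegral.integral_sub (hint (by linarith) (by linarith) hT2.ne')
      (hint h₁' (by linarith) h₁₂'.ne),
    circleIntegral_radius_congr' (f := fun w => A w * B w) hρ (by linarith : ρ < R₂') hR
      fun z hz => (hA z hz).mul (hB z hz), ← circleIntegral.integral_const_mul]
  refine circleIntegral.integral_congr (by linarith) fun w hw => ?_
  have hw' : ‖w‖ = R₂' := by simpa using hw
  have key := circleIntegral_div_sub_sub (A := A) (by linarith) (hw' ▸ h₁₂') (hw' ▸ hT2)
    fun z hz => hA z (by linarith)
  have : ∀ z, A z * B w / (z - w) = B w * (A z / (z - w)) := fun z => by ring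
  simp only [this, circleIntegral.integral_const_mul]
  linear_combination B w * key

end Contour

/-! ### The `θ`-integral as an alternating form of pairs of rows. -/

section Form

/-- The determinant as a continuous alternating form of its rows. -/
noncomputable def detForm (N : ℕ) : (Fin N → ℂ) [⋀^Fin N]→L[ℂ] ℂ :=
  { (Matrix.detRowAlternating : (Fin N → ℂ) [⋀^Fin N]→ₗ[ℂ] ℂ) with
    cont := Continuous.matrix_det (A := fun v : Fin N → Fin N → ℂ => (v : Matrix _ _ ℂ))
      continuous_id }

theorem detForm_apply {N : ℕ} (v : Fin N → Fin N → ℂ) : detForm N v = (Matrix.of v).det := rfl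

/-- The contour functional `p ↦ (2πi)⁻¹ ∮ θ⁻ⁿ p(θ) / (θ - 1) dθ`. -/
noncomputable def thetaFunctional (n : ℕ) (r : ℝ) (p : ℂ → ℂ) : ℂ :=
  1 / (2 * π * Complex.I) * ∮ θ in C(0, r), (θ ^ n)⁻¹ * p θ / (θ - 1)

/-- The pencil `(θ - 1) u + d` of the rows `(u, d)`. -/
noncomputable def pencil (N : ℕ) (θ : ℂ) : ((Fin N → ℂ) × (Fin N → ℂ)) →L[ℂ] (Fin N → ℂ) :=
  (θ - 1) • ContinuousLinearMap.fst ℂ _ _ + ContinuousLinearMap.snd ℂ _ _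

/-- The alternating form `(u, d) ↦ (2πi)⁻¹ ∮ θ⁻ⁿ det ((θ - 1) u + d) / (θ - 1) dθ` of pairs of rows,
written as a finite sum by interpolation of the determinant. -/
noncomputable def twoTimeForm (n N : ℕ) (r : ℝ) :
    ((Fin N → ℂ) × (Fin N → ℂ)) [⋀^Fin N]→L[ℂ] ℂ :=
  ∑ l ∈ Finset.range (N + 1),
    thetaFunctional n r (fun θ =>
      (Lagrange.basis (Finset.range (N + 1)) (fun k : ℕ => (k : ℂ)) l).eval θ) •
    (detForm N).compContinuousLinearMap (pencil N l)

theorem circleIntegrable_theta {r : ℝ} (hr : 1 < r) (n : ℕ) {p : ℂ → ℂ} (hp : Continuous p) :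
    CircleIntegrable (fun θ => (θ ^ n)⁻¹ * p θ / (θ - 1)) 0 r := by
  refine ContinuousOn.circleIntegrable (by linarith) ?_
  have h1 : ∀ θ ∈ Metric.sphere (0 : ℂ) r, θ ^ n ≠ 0 := by
    rintro θ hθ
    refine pow_ne_zero _ ?_
    rintro rfl
    simp at hθ; linarith
  have h2 : ∀ θ ∈ Metric.sphere (0 : ℂ) r, θ - 1 ≠ 0 := by
    rintro θ hθ h0
    rw [sub_eq_zero.1 h0] at hθ
    simp at hθ; linarith
  exact ((ContinuousOn.inv₀ (by fun_prop) h1).mul hp.continuousOn).div (by fun_prop) h2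

/-- The determinant of the pencil as a polynomial. -/
noncomputable def pencilPoly {N : ℕ} (v : Fin N → (Fin N → ℂ) × (Fin N → ℂ)) : Polynomial ℂ :=
  (Matrix.of fun i j => (Polynomial.X - 1) * Polynomial.C ((v i).1 j) +
    Polynomial.C ((v i).2 j)).det

theorem eval_pencilPoly {N : ℕ} (v : Fin N → (Fin N → ℂ) × (Fin N → ℂ)) (θ : ℂ) :
    (pencilPoly v).eval θ = detForm N fun i => pencil N θ (v i) := by
  rw [pencilPoly, ← Polynomial.coe_evalRingHom, RingHom.map_det, detForm_apply]
  congr 1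
  ext i j
  simp [pencil]

/-- Each term of the Leibniz expansion takes one factor per row, and only rows with a nonzero first
component contain `θ`. -/
theorem natDegree_pencilPoly_le {N : ℕ} (v : Fin N → (Fin N → ℂ) × (Fin N → ℂ)) (s : Finset (Fin N))
    (hs : ∀ i, i ∉ s → (v i).1 = 0) : (pencilPoly v).natDegree ≤ s.card := by
  rw [pencilPoly, Matrix.det_apply]
  refine Polynomial.natDegree_sum_le_of_forall_le _ _ fun σ _ => ?_
  refine (Polynomial.natDegree_smul_le _ _).trans ((Polynomial.natDegree_prod_le _ _).trans ?_)
  have : ∀ i : Fin N, ((Polynomial.X - 1) * Polynomial.C ((v (σ i)).1 i) +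
      Polynomial.C ((v (σ i)).2 i) : Polynomial ℂ).natDegree ≤ if σ i ∈ s then 1 else 0 := by
    intro i
    split_ifs with h
    · compute_degree
    · rw [hs _ h]; simp
  refine (Finset.sum_le_sum fun i _ => this i).trans ?_
  rw [Equiv.sum_comp σ (fun i => if i ∈ s then 1 else 0)]
  simp

/-- The determinant has degree at most `N` in `θ`, so interpolation at the `N + 1` nodes `0, …, N`
is exact. -/
theorem twoTimeForm_apply {n N : ℕ} {r : ℝ} (hr : 1 < r)
    (v : Fin N → (Fin N → ℂ) × (Fin N → ℂ)) :
    twoTimeForm n N r v = thetaFunctional n r fun θ => detForm N fun i => pencil N θ (v i) := by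
  have hdeg : (pencilPoly v).degree < (Finset.range (N + 1)).card := by
    refine lt_of_le_of_lt Polynomial.degree_le_natDegree ?_
    have := natDegree_pencilPoly_le v Finset.univ (by simp)
    rw [Finset.card_univ, Fintype.card_fin] at this
    rw [Finset.card_range]
    exact_mod_cast Nat.lt_succ_of_le this
  have hinj : Set.InjOn (fun k : ℕ => (k : ℂ)) (Finset.range (N + 1)) :=
    Nat.cast_injective.injOn
  have hint := Lagrange.eq_interpolate hinj hdeg
  have heval : ∀ θ : ℂ, (detForm N fun i => pencil N θ (v i)) =
      ∑ l ∈ Finset.range (N + 1), (detForm N fun i => pencil N l (v i)) *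
        (Lagrange.basis (Finset.range (N + 1)) (fun k : ℕ => (k : ℂ)) l).eval θ := by
    intro θ
    rw [← eval_pencilPoly]
    conv_lhs => rw [hint]
    rw [Lagrange.interpolate_apply, Polynomial.eval_finsetSum]
    simp [eval_pencilPoly]
  rw [funext heval, thetaFunctional]
  have : ∀ θ : ℂ, (θ ^ n)⁻¹ * (∑ l ∈ Finset.range (N + 1), (detForm N fun i => pencil N l (v i)) *
        (Lagrange.basis (Finset.range (N + 1)) (fun k : ℕ => (k : ℂ)) l).eval θ) / (θ - 1) =
      ∑ l ∈ Finset.range (N + 1), (detForm N fun i => pencil N l (v i)) * ((θ ^ n)⁻¹ *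
        (Lagrange.basis (Finset.range (N + 1)) (fun k : ℕ => (k : ℂ)) l).eval θ / (θ - 1)) := by
    intro θ
    rw [Finset.mul_sum, Finset.sum_div]
    exact Finset.sum_congr rfl fun l _ => by ring
  rw [funext this]
  rw [circleIntegral.integral_fun_sum, Finset.mul_sum]
  · simp only [circleIntegral.integral_const_mul, twoTimeForm]
    rw [ContinuousAlternatingMap.sum_apply]
    refine Finset.sum_congr rfl fun l _ => ?_
    simp only [thetaFunctional, ContinuousAlternatingMap.smul_apply, smul_eq_mul,
      ContinuousAlternatingMap.compContinuousLinearMap_apply, Function.comp_def]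
    ring
  · intro l _
    have := (circleIntegrable_theta hr n
      (Polynomial.continuous (Lagrange.basis (Finset.range (N + 1)) (fun k : ℕ => (k : ℂ)) l))
      ).const_smul (a := detForm N fun i => pencil N l (v i))
    exact this

theorem tendsto_inv_sub_cobounded (a : ℂ) :
    Filter.Tendsto (fun z : ℂ => (z - a)⁻¹) (Bornology.cobounded ℂ) (nhds 0) :=
  Filter.tendsto_inv₀_cobounded.comp (tendsto_sub_const_cobounded a)

theorem tendsto_mul_inv_sub_cobounded (a : ℂ) :
    Filter.Tendsto (fun z : ℂ => z * (z - a)⁻¹) (Bornology.cobounded ℂ) (nhds 1) := by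
  have h := (tendsto_inv_sub_cobounded a).const_mul a |>.const_add 1
  rw [mul_zero, add_zero] at h
  refine h.congr' ?_
  filter_upwards [Bornology.eventually_ne_cobounded a] with z hz
  have : z - a ≠ 0 := sub_ne_zero.2 hz
  field_simp
  ring

/-- The integrand is `O(θ⁻²)` at infinity, and both poles `0` and `1` lie inside the circle. -/
theorem thetaFunctional_eq_zero {n : ℕ} {r : ℝ} (hr : 1 < r) {p : Polynomial ℂ}
    (hp : p.natDegree < n) : thetaFunctional n r (fun θ => p.eval θ) = 0 := by
  rw [thetaFunctional, circleIntegral_eq_zero_of_decay (by linarith), mul_zero]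
  · intro z hz
    have h1 : z ≠ 0 := by rintro rfl; simp at hz; linarith
    have h2 : z - 1 ≠ 0 := by
      intro h0; rw [sub_eq_zero.1 h0] at hz; simp at hz; linarith
    exact (((differentiableAt_id.pow n).inv (pow_ne_zero _ h1)).mul
      p.differentiable.differentiableAt).div (by fun_prop) h2
  · have h1 : Filter.Tendsto (fun z : ℂ => p.eval z * (z ^ n)⁻¹) (Bornology.cobounded ℂ)
        (nhds 0) := by
      have h2 : ∀ z : ℂ, z ≠ 0 → ∑ k ∈ Finset.range n, p.coeff k * (z⁻¹) ^ (n - k) =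
          p.eval z * (z ^ n)⁻¹ := by
        intro z hz
        rw [Polynomial.eval_eq_sum_range' hp, Finset.sum_mul]
        refine Finset.sum_congr rfl fun k hk => ?_
        have : z ^ n = z ^ (n - k) * z ^ k := by
          rw [← pow_add, Nat.sub_add_cancel (Finset.mem_range.1 hk).le]
        rw [this, inv_pow]
        field_simp
      have h3 : Filter.Tendsto (fun z : ℂ => ∑ k ∈ Finset.range n, p.coeff k * (z⁻¹) ^ (n - k))
          (Bornology.cobounded ℂ) (nhds (∑ k ∈ Finset.range n, p.coeff k * 0 ^ (n - k))) :=
        tendsto_finsetSum _ fun k _ => (Filter.tendsto_inv₀_cobounded.pow _).const_mul _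
      have h4 : ∑ k ∈ Finset.range n, p.coeff k * (0 : ℂ) ^ (n - k) = 0 :=
        Finset.sum_eq_zero fun k hk => by
          rw [zero_pow (by have := Finset.mem_range.1 hk; omega), mul_zero]
      rw [h4] at h3
      refine h3.congr' ?_
      filter_upwards [Bornology.eventually_ne_cobounded (0 : ℂ)] with z hz
      exact h2 z hz
    have := h1.mul (tendsto_mul_inv_sub_cobounded 1)
    rw [zero_mul] at this
    refine this.congr fun z => ?_
    ring

theorem twoTimeForm_eq_zero {n N : ℕ} {r : ℝ} (hr : 1 < r) (hn : 1 ≤ n)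
    {v : Fin N → (Fin N → ℂ) × (Fin N → ℂ)} (hv : ∀ i : Fin N, n ≤ (i : ℕ) + 1 → (v i).1 = 0) :
    twoTimeForm n N r v = 0 := by
  rw [twoTimeForm_apply hr]
  simp only [← eval_pencilPoly]
  refine thetaFunctional_eq_zero hr ?_
  refine (natDegree_pencilPoly_le v (Finset.univ.filter fun i : Fin N => (i : ℕ) + 1 < n)
    fun i hi => hv i (by simpa using hi)).trans_lt ?_
  have h1 : (Finset.univ.filter fun i : Fin N => (i : ℕ) + 1 < n).card ≤
      (Finset.range (n - 1)).card := by
    refine Finset.card_le_card_of_injOn (fun i => (i : ℕ)) (fun i hi => ?_)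
      (fun a _ b _ hab => Fin.ext hab)
    simp at hi ⊢
    omega
  rw [Finset.card_range] at h1
  omega

theorem prod_fin_ite {N n : ℕ} (hn : n ≤ N) (θ : ℂ) :
    (∏ i : Fin N, if (i : ℕ) < n then θ else 1) = θ ^ n := by
  rw [Fin.prod_univ_eq_prod_range (fun i => if i < n then θ else 1) N, Finset.prod_ite]
  have : (Finset.range N).filter (fun i => i < n) = Finset.range n := by
    ext i; simp; omega
  simp [this]

/-- A row with equal components `d` has pencil `θ d`. The `n` factors `θ` cancel `θ⁻ⁿ`, only the
pole at `θ = 1` remains, and there the pencil is the second component. -/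
theorem twoTimeForm_eq_det {n N : ℕ} {r : ℝ} (hr : 1 < r) (hn : n ≤ N)
    {v : Fin N → (Fin N → ℂ) × (Fin N → ℂ)} (hv : ∀ i : Fin N, (i : ℕ) < n → (v i).1 = (v i).2) :
    twoTimeForm n N r v = detForm N fun i => (v i).2 := by
  rw [twoTimeForm_apply hr, thetaFunctional]
  set q : ℂ → ℂ := fun θ => detForm N fun i =>
    if (i : ℕ) < n then (v i).2 else pencil N θ (v i) with hq
  have h1 : ∀ θ : ℂ, (detForm N fun i => pencil N θ (v i)) = θ ^ n * q θ := by
    intro θ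
    rw [← prod_fin_ite hn, hq]
    simp only [detForm_apply]
    rw [← Matrix.det_mul_column]
    congr 1
    ext i j
    by_cases h : (i : ℕ) < n
    · simp [h, pencil, hv i h]; ring
    · simp [h]
  have hqd : Differentiable ℂ q := by
    simp only [hq, detForm_apply, Matrix.det_apply]
    refine Differentiable.fun_sum fun σ _ => Differentiable.const_smul ?_ _
    refine Differentiable.fun_finsetProd fun i _ => ?_
    by_cases h : ((σ i : Fin N) : ℕ) < n
    · simp [h]
    · simp only [Matrix.of_apply, h, if_false, pencil, add_apply,
        smul_apply, Pi.add_apply, Pi.smul_apply, smul_eq_mul]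
      fun_prop
  have h2 : (∮ θ in C(0, r), (θ ^ n)⁻¹ * (detForm N fun i => pencil N θ (v i)) / (θ - 1)) =
      ∮ θ in C(0, r), (θ - 1)⁻¹ • q θ := by
    refine circleIntegral.integral_congr (by linarith) fun θ hθ => ?_
    have h0 : θ ≠ 0 := by rintro rfl; simp at hθ; linarith
    simp only [h1, smul_eq_mul]
    field_simp
  have h3 := hqd.differentiableOn.circleIntegral_sub_inv_smul (c := 0) (R := r) (w := 1)
    (by simpa using hr)
  rw [h2, h3, smul_eq_mul, ← mul_assoc, one_div, inv_mul_cancel₀ Complex.two_pi_I_ne_zero, one_mul]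
  simp only [hq]
  congr 1
  ext i j
  by_cases h : (i : ℕ) < n
  · simp [h]
  · simp [h, pencil]

/-- Row by row, the pencil is `θ A - B`; distributing `θ⁻ⁿ` as one factor `θ⁻¹` to each of the first
`n` rows gives the stated powers of `θ`. -/
theorem twoTimeForm_eq_thetaCombination {n N : ℕ} {r : ℝ} (hr : 1 < r) (hn : n ≤ N)
    (A B : Matrix (Fin N) (Fin N) ℂ) :
    twoTimeForm n N r (fun i => (fun j => A i j, fun j => A i j - B i j)) =
      1 / (2 * π * Complex.I) * ∮ θ in C(0, r), (thetaCombination n N A B θ).det / (θ - 1) := by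
  rw [twoTimeForm_apply hr, thetaFunctional]
  congr 1
  refine circleIntegral.integral_congr (by linarith) fun θ hθ => ?_
  have h0 : θ ≠ 0 := by rintro rfl; simp at hθ; linarith
  congr 1
  rw [← inv_pow, ← prod_fin_ite hn, detForm_apply, ← Matrix.det_mul_column]
  congr 1
  ext i j
  by_cases h : (i : ℕ) < n
  · have h1 : ¬ n ≤ (i : ℕ) := by omega
    simp [h, h1, pencil, thetaCombination]
    field_simp
    ring
  · have h1 : n ≤ (i : ℕ) := by omega
    simp [h, h1, pencil, thetaCombination]
    ring

end Form

/-! ### The two differential equations of the contour rows. -/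

section Rows

/-- The rational factor of row `i` when the rows `t + 1, …, m` of weights are still to come. -/
noncomputable def rowFactor (α β : ℕ → ℝ) (m t i : ℕ) (z : ℂ) : ℂ :=
  (∏ k ∈ Finset.Icc 1 i, (z - β k))⁻¹ * ∏ k ∈ Finset.Icc (t + 1) m, ((α k + β i : ℂ) / (z + α k))

/-- The contour integral that makes up the entries of row `i`, as a function of the position `x`. -/
noncomputable def contourRow (α β : ℕ → ℝ) (m : ℕ) (R h : ℝ) (K : ℂ → ℂ) (t i : ℕ) (x : ℝ) : ℂ :=
  ∮ z in C(0, R), Complex.exp ((z - β i) * (h - x)) * (rowFactor α β m t i z * K z)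

/-- The parameters `α 1, …, α M` and `β 1, …, β N` lie in the closed disc of radius `ρ`. -/
structure InDisc (α β : ℕ → ℝ) (M N : ℕ) (ρ : ℝ) : Prop where
  nonneg : 0 ≤ ρ
  alpha : ∀ k ∈ Finset.Icc 1 M, |α k| ≤ ρ
  beta : ∀ k ∈ Finset.Icc 1 N, |β k| ≤ ρ

theorem sub_ofReal_ne_zero {z : ℂ} {b ρ : ℝ} (hb : |b| ≤ ρ) (hz : ρ < ‖z‖) : z - b ≠ 0 := by
  intro h0
  rw [sub_eq_zero.1 h0, Complex.norm_real, Real.norm_eq_abs] at hz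
  linarith

theorem add_ofReal_ne_zero {z : ℂ} {b ρ : ℝ} (hb : |b| ≤ ρ) (hz : ρ < ‖z‖) : z + b ≠ 0 := by
  have := sub_ofReal_ne_zero (b := -b) (by simpa using hb) hz
  simpa using this

variable {α β : ℕ → ℝ} {M N : ℕ} {ρ : ℝ}

theorem InDisc.prod_beta_ne_zero (hD : InDisc α β M N ρ) {i j : ℕ} (hi : 1 ≤ i) (hj : j ≤ N) {z : ℂ}
    (hz : ρ < ‖z‖) : ∏ k ∈ Finset.Icc i j, (z - β k) ≠ 0 := by
  refine Finset.prod_ne_zero_iff.2 fun k hk => ?_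
  rw [Finset.mem_Icc] at hk
  exact sub_ofReal_ne_zero (hD.beta k (Finset.mem_Icc.2 ⟨by omega, by omega⟩)) hz

theorem InDisc.differentiableAt_alpha (hD : InDisc α β M N ρ) (t : ℕ) {m : ℕ} (hm : m ≤ M) (c : ℂ)
    {z : ℂ} (hz : ρ < ‖z‖) :
    DifferentiableAt ℂ (fun z : ℂ => ∏ k ∈ Finset.Icc (t + 1) m, ((α k + c) / (z + α k))) z := by
  refine DifferentiableAt.fun_finsetProd fun k hk => ?_
  rw [Finset.mem_Icc] at hk
  refine DifferentiableAt.div (by fun_prop) (by fun_prop) ?_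
  exact add_ofReal_ne_zero (hD.alpha k (Finset.mem_Icc.2 ⟨by omega, by omega⟩)) hz

theorem InDisc.differentiableAt_rowFactor (hD : InDisc α β M N ρ) {m i : ℕ} (hm : m ≤ M)
    (hi : i ≤ N) (t : ℕ) {z : ℂ} (hz : ρ < ‖z‖) : DifferentiableAt ℂ (rowFactor α β m t i) z := by
  unfold rowFactor
  have h1 : DifferentiableAt ℂ (fun z : ℂ => ∏ k ∈ Finset.Icc 1 i, (z - β k)) z := by fun_prop
  exact (h1.inv (hD.prod_beta_ne_zero le_rfl hi hz)).mul
    (hD.differentiableAt_alpha t hm _ hz)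

theorem InDisc.hasDerivAt_contourRow (hD : InDisc α β M N ρ) {m i : ℕ} (hm : m ≤ M) (hi : i ≤ N)
    (t : ℕ) {R : ℝ} (hR : ρ < R) {K : ℂ → ℂ} (hK : ContinuousOn K (Metric.sphere 0 R)) (h x : ℝ) :
    HasDerivAt (contourRow α β m R h K t i)
      (∮ z in C(0, R), -(z - β i) * (Complex.exp ((z - β i) * (h - x)) *
        (rowFactor α β m t i z * K z))) x := by
  refine hasDerivAt_circleIntegral_exp ?_ (β i) h x
  rw [abs_of_pos (hD.nonneg.trans_lt hR)]
  refine ContinuousOn.mul (fun z hz => ?_) hK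
  refine (hD.differentiableAt_rowFactor hm hi t ?_).continuousAt.continuousWithinAt
  rwa [mem_sphere_zero_iff_norm.1 hz]

theorem InDisc.circleIntegrable_contourRow (hD : InDisc α β M N ρ) {m i : ℕ} (hm : m ≤ M)
    (hi : i ≤ N) (t : ℕ) {R : ℝ} (hR : ρ < R) {K : ℂ → ℂ}
    (hK : ContinuousOn K (Metric.sphere 0 R)) (h x : ℝ) :
    CircleIntegrable (fun z => Complex.exp ((z - β i) * (h - x)) * (rowFactor α β m t i z * K z))
      0 R := by
  refine ContinuousOn.circleIntegrable (hD.nonneg.trans hR.le) ?_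
  refine ContinuousOn.mul (by fun_prop) (ContinuousOn.mul (fun z hz => ?_) hK)
  refine (hD.differentiableAt_rowFactor hm hi t ?_).continuousAt.continuousWithinAt
  rwa [mem_sphere_zero_iff_norm.1 hz]

/-- Differentiating the exponential brings down `-(z - β i)`, which is `(α (t + 1) + β i) - (z + α
(t + 1))`; the second term cancels the factor of row `t + 1`. -/
theorem InDisc.hasDerivAt_contourRow_self (hD : InDisc α β M N ρ) {m i t : ℕ} (hm : m ≤ M)
    (hi : i ≤ N) (ht : t < m) {R : ℝ} (hR : ρ < R) {K : ℂ → ℂ}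
    (hK : ContinuousOn K (Metric.sphere 0 R)) (h x : ℝ) :
    HasDerivAt (contourRow α β m R h K t i) ((α (t + 1) + β i) *
      (contourRow α β m R h K t i x - contourRow α β m R h K (t + 1) i x)) x := by
  refine (hD.hasDerivAt_contourRow hm hi t hR hK h x).congr_deriv ?_
  unfold contourRow
  rw [← circleIntegral.integral_sub (hD.circleIntegrable_contourRow hm hi t hR hK h x)
    (hD.circleIntegrable_contourRow hm hi (t + 1) hR hK h x), ← circleIntegral.integral_const_mul]
  refine circleIntegral.integral_congr (hD.nonneg.trans hR.le) fun z hz => ?_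
  have hz' : ρ < ‖z‖ := by rwa [mem_sphere_zero_iff_norm.1 hz]
  have hne := add_ofReal_ne_zero (hD.alpha (t + 1) (Finset.mem_Icc.2 ⟨by omega, by omega⟩)) hz'
  have hs : rowFactor α β m t i z =
      (α (t + 1) + β i) / (z + α (t + 1)) * rowFactor α β m (t + 1) i z := by
    unfold rowFactor
    rw [← Finset.insert_Icc_add_one_left_eq_Icc (Nat.succ_le_of_lt ht),
      Finset.prod_insert (by simp)]
    ring
  simp only [hs]
  field_simp
  ring

/-- The factor `-(z - β (l + 1))` cancels the last pole of row `l + 1`, and the numerators and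
exponential shift change only by constants in `z`. The multiplier may depend on `x` but not on `K`:
it must serve all columns and both components of a pair at once. -/
theorem InDisc.hasDerivAt_contourRow_pred (hD : InDisc α β M N ρ)
    (hαβ : ∀ i j : ℕ, 1 ≤ i → 1 ≤ j → 0 < α i + β j) {m l : ℕ} (hm : m ≤ M) (hl : 1 ≤ l)
    (hlN : l + 1 ≤ N) (t : ℕ) {R : ℝ} (hR : ρ < R) (h x : ℝ) :
    ∃ c : ℂ, ∀ K : ℂ → ℂ, ContinuousOn K (Metric.sphere 0 R) →
      HasDerivAt (contourRow α β m R h K t (l + 1)) (c * contourRow α β m R h K t l x) x := by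
  refine ⟨-(Complex.exp ((β l - β (l + 1)) * (h - x)) *
    ∏ k ∈ Finset.Icc (t + 1) m, ((α k + β (l + 1) : ℂ) / (α k + β l))), fun K hK => ?_⟩
  refine (hD.hasDerivAt_contourRow hm hlN t hR hK h x).congr_deriv ?_
  unfold contourRow
  rw [← circleIntegral.integral_const_mul]
  refine circleIntegral.integral_congr (hD.nonneg.trans hR.le) fun z hz => ?_
  have hz' : ρ < ‖z‖ := by rwa [mem_sphere_zero_iff_norm.1 hz]
  have hne := sub_ofReal_ne_zero (hD.beta (l + 1) (Finset.mem_Icc.2 ⟨by omega, by omega⟩)) hz'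
  have he : Complex.exp ((z - β (l + 1)) * (h - x)) =
      Complex.exp ((β l - β (l + 1)) * (h - x)) * Complex.exp ((z - β l) * (h - x)) := by
    rw [← Complex.exp_add]; congr 1; ring
  have hp : ∏ k ∈ Finset.Icc (t + 1) m, ((α k + β (l + 1) : ℂ) / (z + α k)) =
      (∏ k ∈ Finset.Icc (t + 1) m, ((α k + β (l + 1) : ℂ) / (α k + β l))) *
        ∏ k ∈ Finset.Icc (t + 1) m, ((α k + β l : ℂ) / (z + α k)) := by
    rw [← Finset.prod_mul_distrib]
    refine Finset.prod_congr rfl fun k hk => ?_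
    rw [Finset.mem_Icc] at hk
    have : (α k + β l : ℂ) ≠ 0 := by
      have := hαβ k l (by omega) hl
      exact_mod_cast this.ne'
    rw [div_mul_div_comm, mul_comm (α k + β (l + 1) : ℂ), mul_div_mul_left _ _ this]
  simp only [rowFactor]
  rw [he, hp, Finset.prod_Icc_succ_top (by omega), mul_inv]
  field_simp

end Rows

/-! ### The double contour integrals, their residues, and their values at the thresholds. -/

section Entries

/-- The factor of the two-time integrand that depends on `z`, with `t` rows of weights removed. -/
noncomputable def zFactor (α β : ℕ → ℝ) (m n : ℕ) (h : ℝ) (t i : ℕ) (x : ℝ) (z : ℂ) : ℂ :=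
  Complex.exp ((z - β i) * (h - x)) * (rowFactor α β m t i z * ∏ k ∈ Finset.Icc 1 n, (z - β k))

/-- The factor of the two-time integrand that depends on `w`. -/
noncomputable def wFactor (α β : ℕ → ℝ) (m n M : ℕ) (h H : ℝ) (j : ℕ) (w : ℂ) : ℂ :=
  Complex.exp ((w - β j) * (H - h)) *
    ((∏ k ∈ Finset.Icc 1 (j - 1), (w - β k)) / ∏ k ∈ Finset.Icc 1 n, (w - β k)) *
    ∏ k ∈ Finset.Icc (m + 1) M, ((α k + β j : ℂ) / (w + α k))

/-- The kernel for which `contourRow` is the double contour integral. -/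
noncomputable def doubleKernel (α β : ℕ → ℝ) (m n M : ℕ) (h H R₂ : ℝ) (j : ℕ) (z : ℂ) : ℂ :=
  1 / (2 * π * Complex.I) ^ 2 * ((∏ k ∈ Finset.Icc 1 n, (z - β k)) *
    ∮ w in C(0, R₂), wFactor α β m n M h H j w / (z - w))

/-- The kernel for which `contourRow` is the residue of the double contour integral. -/
noncomputable def residueKernel (α β : ℕ → ℝ) (m n M : ℕ) (h H : ℝ) (j : ℕ) (z : ℂ) : ℂ :=
  1 / (2 * π * Complex.I) * ((∏ k ∈ Finset.Icc 1 n, (z - β k)) * wFactor α β m n M h H j z)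

/-- The kernel for which `contourRow` gives the one-time determinant. -/
noncomputable def oneTimeKernel (β : ℕ → ℝ) (j : ℕ) (z : ℂ) : ℂ :=
  1 / (2 * π * Complex.I) * ∏ k ∈ Finset.Icc 1 (j - 1), (z - β k)

variable {α β : ℕ → ℝ} {M N : ℕ} {ρ : ℝ}

theorem contourRow_doubleKernel (α β : ℕ → ℝ) (m n M : ℕ) (h H R₁ R₂ : ℝ) (t i j : ℕ) (x : ℝ) :
    contourRow α β m R₁ h (doubleKernel α β m n M h H R₂ j) t i x =
      1 / (2 * π * Complex.I) ^ 2 * ∮ z in C(0, R₁), ∮ w in C(0, R₂),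
        zFactor α β m n h t i x z * wFactor α β m n M h H j w / (z - w) := by
  rw [← circleIntegral.integral_const_mul]
  unfold contourRow
  congr 1
  ext z
  have : ∀ w, zFactor α β m n h t i x z * wFactor α β m n M h H j w / (z - w) =
      zFactor α β m n h t i x z * (wFactor α β m n M h H j w / (z - w)) := fun w => by ring
  rw [funext this, circleIntegral.integral_const_mul, zFactor, doubleKernel]
  ring

theorem contourRow_residueKernel (α β : ℕ → ℝ) (m n M : ℕ) (h H R : ℝ) (t i j : ℕ) (x : ℝ) :
    contourRow α β m R h (residueKernel α β m n M h H j) t i x =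
      1 / (2 * π * Complex.I) * ∮ z in C(0, R),
        zFactor α β m n h t i x z * wFactor α β m n M h H j z := by
  rw [← circleIntegral.integral_const_mul]
  unfold contourRow
  congr 1
  ext z
  rw [zFactor, residueKernel]
  ring

theorem twoTimeIntegrand_eq (α β x : ℕ → ℝ) (m n M : ℕ) (h H : ℝ) (i j : ℕ) (z w : ℂ) :
    twoTimeIntegrand α β x m n M h H i j z w =
      zFactor α β m n h 0 i (x i) z * wFactor α β m n M h H j w / (z - w) := by
  have : Complex.exp ((z - β i) * h + (w - β j) * (H - h) - x i * (z - β i)) =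
      Complex.exp ((z - β i) * (h - x i)) * Complex.exp ((w - β j) * (H - h)) := by
    rw [← Complex.exp_add]; congr 1; ring
  rw [twoTimeIntegrand, zFactor, wFactor, rowFactor, this]
  ring

theorem twoTimeMatrix_eq (α β x : ℕ → ℝ) (m n M N : ℕ) (h H R₁ R₂ : ℝ) (i j : Fin N) :
    twoTimeMatrix α β x m n M N h H R₁ R₂ i j =
      1 / (2 * π * Complex.I) ^ 2 * ∮ z in C(0, R₁), ∮ w in C(0, R₂),
        zFactor α β m n h 0 (i + 1) (x (i + 1)) z * wFactor α β m n M h H (j + 1) w / (z - w) := by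
  simp only [twoTimeMatrix, Matrix.of_apply, twoTimeIntegrand_eq]

theorem InDisc.differentiableAt_zFactor (hD : InDisc α β M N ρ) {m i : ℕ} (hm : m ≤ M)
    (hi : i ≤ N) (n t : ℕ) (h x : ℝ) {z : ℂ} (hz : ρ < ‖z‖) :
    DifferentiableAt ℂ (zFactor α β m n h t i x) z := by
  unfold zFactor
  have := hD.differentiableAt_rowFactor hm hi t hz
  exact DifferentiableAt.mul (by fun_prop) (this.mul (by fun_prop))

theorem InDisc.differentiableAt_wFactor (hD : InDisc α β M N ρ) {n : ℕ} (hn : n ≤ N) (m : ℕ)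
    (h H : ℝ) (j : ℕ) {z : ℂ} (hz : ρ < ‖z‖) :
    DifferentiableAt ℂ (wFactor α β m n M h H j) z := by
  unfold wFactor
  have h1 : DifferentiableAt ℂ (fun z : ℂ => (∏ k ∈ Finset.Icc 1 (j - 1), (z - β k)) /
      ∏ k ∈ Finset.Icc 1 n, (z - β k)) z :=
    DifferentiableAt.div (by fun_prop) (by fun_prop) (hD.prod_beta_ne_zero le_rfl hn hz)
  exact (DifferentiableAt.mul (by fun_prop) h1).mul (hD.differentiableAt_alpha m le_rfl _ hz)

theorem InDisc.continuousOn_doubleKernel (hD : InDisc α β M N ρ) {n : ℕ} (hn : n ≤ N) (m : ℕ)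
    (h H : ℝ) (j : ℕ) {R₁ R₂ : ℝ} (h₂ : ρ < R₂) (h₁ : R₂ < R₁) :
    ContinuousOn (doubleKernel α β m n M h H R₂ j) (Metric.sphere 0 R₁) := by
  refine ContinuousOn.mul continuousOn_const (ContinuousOn.mul (by fun_prop) ?_)
  have := continuousOn_cauchyKernel (A := fun _ => 1) (B := wFactor α β m n M h H j) hD.nonneg
    (h₂.trans h₁) h₂ h₁.ne' (fun _ _ => continuousAt_const)
    (fun z hz => (hD.differentiableAt_wFactor hn m h H j hz).continuousAt)
  rw [abs_of_pos (hD.nonneg.trans_lt (h₂.trans h₁))] at this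
  simp only [one_mul] at this
  exact continuousOn_circleIntegral_right this

theorem InDisc.continuousOn_residueKernel (hD : InDisc α β M N ρ) {n : ℕ} (hn : n ≤ N) (m : ℕ)
    (h H : ℝ) (j : ℕ) {R : ℝ} (hR : ρ < R) :
    ContinuousOn (residueKernel α β m n M h H j) (Metric.sphere 0 R) := by
  refine ContinuousOn.mul continuousOn_const (ContinuousOn.mul (by fun_prop) fun z hz => ?_)
  refine (hD.differentiableAt_wFactor hn m h H j ?_).continuousAt.continuousWithinAt
  rwa [mem_sphere_zero_iff_norm.1 hz]

theorem continuous_oneTimeKernel (β : ℕ → ℝ) (j : ℕ) : Continuous (oneTimeKernel β j) := by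
  unfold oneTimeKernel
  fun_prop

/-- The difference of the two orders of the radii is the residue. -/
theorem InDisc.sub_eq_contourRow_residueKernel (hD : InDisc α β M N ρ) {m n i : ℕ} (hm : m ≤ M)
    (hn : n ≤ N) (hi : i ≤ N) (t j : ℕ) (h H x : ℝ) {R₁ R₂ R₁' R₂' R : ℝ} (h₂ : ρ < R₂)
    (h₂₁ : R₂ < R₁) (h₁' : ρ < R₁') (h₁₂' : R₁' < R₂') (hR : ρ < R) :
    1 / (2 * π * Complex.I) ^ 2 * (∮ z in C(0, R₁), ∮ w in C(0, R₂),
        zFactor α β m n h t i x z * wFactor α β m n M h H j w / (z - w)) -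
      1 / (2 * π * Complex.I) ^ 2 * (∮ z in C(0, R₁'), ∮ w in C(0, R₂'),
        zFactor α β m n h t i x z * wFactor α β m n M h H j w / (z - w)) =
      contourRow α β m R h (residueKernel α β m n M h H j) t i x := by
  rw [contourRow_residueKernel, ← mul_sub,
    circleIntegral_circleIntegral_sub hD.nonneg h₂ h₂₁ h₁' h₁₂' hR
      (fun z hz => hD.differentiableAt_zFactor hm hi n t h x hz)
      (fun z hz => hD.differentiableAt_wFactor hn m h H j hz)]
  have := Complex.two_pi_I_ne_zero
  field_simp

theorem prod_Icc_inv_mul_prod_Icc {f : ℕ → ℂ} {n i : ℕ} (hni : n ≤ i)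
    (hf : ∀ k, 1 ≤ k → k ≤ n → f k ≠ 0) :
    (∏ k ∈ Finset.Icc 1 i, f k)⁻¹ * ∏ k ∈ Finset.Icc 1 n, f k =
      ∏ k ∈ Finset.Icc (n + 1) i, (f k)⁻¹ := by
  have h1 : ∏ k ∈ Finset.Icc 1 i, f k =
      (∏ k ∈ Finset.Icc 1 n, f k) * ∏ k ∈ Finset.Icc (n + 1) i, f k := by
    have : Finset.Icc 1 i = Finset.Icc 1 n ∪ Finset.Icc (n + 1) i := by
      ext k; simp only [Finset.mem_union, Finset.mem_Icc]; omega
    rw [this, Finset.prod_union]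
    rw [Finset.disjoint_left]
    intro k hk
    simp only [Finset.mem_Icc] at hk ⊢
    omega
  have h2 : ∏ k ∈ Finset.Icc 1 n, f k ≠ 0 :=
    Finset.prod_ne_zero_iff.2 fun k hk => hf k (Finset.mem_Icc.1 hk).1 (Finset.mem_Icc.1 hk).2
  rw [h1, mul_inv, Finset.prod_inv_distrib]
  field_simp

theorem tendsto_prod_inv_sub_cobounded (s : Finset ℕ) (a : ℕ → ℝ) :
    ∃ l : ℂ, Filter.Tendsto (fun z : ℂ => ∏ k ∈ s, (z - a k)⁻¹) (Bornology.cobounded ℂ) (nhds l) :=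
  ⟨_, tendsto_finsetProd _ fun k _ => tendsto_inv_sub_cobounded (a k : ℂ)⟩

theorem tendsto_prod_div_add_cobounded {s : Finset ℕ} (hs : s.Nonempty) (a : ℕ → ℝ) (c : ℕ → ℂ) :
    Filter.Tendsto (fun z : ℂ => ∏ k ∈ s, (c k / (z + a k))) (Bornology.cobounded ℂ) (nhds 0) := by
  have h1 : ∀ k ∈ s, Filter.Tendsto (fun z : ℂ => c k / (z + a k)) (Bornology.cobounded ℂ)
      (nhds 0) := by
    intro k _
    have := (tendsto_inv_sub_cobounded (-(a k : ℂ))).const_mul (c k)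
    simpa [div_eq_mul_inv] using this
  have := tendsto_finsetProd s h1
  rwa [Finset.prod_const, zero_pow hs.card_pos.ne'] at this

theorem eventually_cobounded_lt_norm (ρ : ℝ) : ∀ᶠ z : ℂ in Bornology.cobounded ℂ, ρ < ‖z‖ := by
  filter_upwards [eventually_cobounded_le_norm (E := ℂ) (ρ + 1)] with z hz
  linarith

/-- A double contour row with a remaining weight and `i ≥ n` vanishes at the threshold `h`. -/
theorem InDisc.contourRow_doubleKernel_eq_zero (hD : InDisc α β M N ρ) {m n i t : ℕ} (hm : m ≤ M)
    (hni : n ≤ i) (hi : i ≤ N) (ht : t < m) (h H : ℝ) (j : ℕ) {R₁ R₂ : ℝ} (h₂ : ρ < R₂)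
    (h₁ : R₂ < R₁) : contourRow α β m R₁ h (doubleKernel α β m n M h H R₂ j) t i h = 0 := by
  have hn : n ≤ N := hni.trans hi
  rw [contourRow_doubleKernel, circleIntegral_circleIntegral_eq_zero hD.nonneg (h₂.trans h₁) h₂
    h₁.ne' (fun z hz => (hD.differentiableAt_zFactor hm hi n t h h hz).continuousAt)
    (fun z hz => (hD.differentiableAt_wFactor hn m h H j hz).continuousAt), mul_zero]
  intro w hw
  refine circleIntegral_eq_zero_of_decay (hD.nonneg.trans_lt (h₂.trans h₁)) (fun z hz => ?_) ?_
  · refine (hD.differentiableAt_zFactor hm hi n t h h (by linarith)).div (by fun_prop) ?_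
    intro h0
    rw [sub_eq_zero.1 h0] at hz
    linarith
  -- At `x = h` the exponential is `1`. What remains is `i - n` factors in `β`, at least one
  -- decaying factor in `α`, and `1 / (z - w)`: together `O(z⁻²)`.
  · obtain ⟨l, hl⟩ := tendsto_prod_inv_sub_cobounded (Finset.Icc (n + 1) i) β
    have h3 := tendsto_prod_div_add_cobounded (s := Finset.Icc (t + 1) m)
      ⟨t + 1, Finset.mem_Icc.2 ⟨le_rfl, ht⟩⟩ α (fun k => (α k + β i : ℂ))
    have h4 := (hl.mul h3).mul (tendsto_mul_inv_sub_cobounded w)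
    rw [mul_zero, zero_mul] at h4
    refine h4.congr' ?_
    filter_upwards [eventually_cobounded_lt_norm ρ] with z hz
    rw [← prod_Icc_inv_mul_prod_Icc hni fun k hk1 hk2 =>
      sub_ofReal_ne_zero (hD.beta k (Finset.mem_Icc.2 ⟨hk1, by omega⟩)) hz]
    simp only [zFactor, rowFactor, sub_self, mul_zero, Complex.exp_zero]
    ring

/-- Without remaining weights and for `i ≤ n`, the double contour row is its residue. -/
theorem InDisc.contourRow_doubleKernel_eq_residue (hD : InDisc α β M N ρ) {m n i : ℕ} (hm : m ≤ M)
    (hin : i ≤ n) (hn : n ≤ N) (h H x : ℝ) (j : ℕ) {R₁ R₂ : ℝ} (h₂ : ρ < R₂) (h₁ : R₂ < R₁) :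
    contourRow α β m R₁ h (doubleKernel α β m n M h H R₂ j) m i x =
      contourRow α β m R₁ h (residueKernel α β m n M h H j) m i x := by
  have hi : i ≤ N := hin.trans hn
  -- The residue is the difference with the integral whose radii are exchanged. There `z` runs
  -- inside the `w`-circle and, all poles in `α` and `β` having cancelled, its integrand is analytic
  -- in the disc, so that integral is zero.
  rw [contourRow_doubleKernel, ← hD.sub_eq_contourRow_residueKernel hm hn hi m j h H x h₂ h₁ h₂ h₁
    (h₂.trans h₁), circleIntegral_circleIntegral_eq_zero (R₁ := R₂) (R₂ := R₁) hD.nonneg h₂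
    (h₂.trans h₁) h₁.ne (fun z hz => (hD.differentiableAt_zFactor hm hi n m h x hz).continuousAt)
    (fun z hz => (hD.differentiableAt_wFactor hn m h H j hz).continuousAt), mul_zero, sub_zero]
  intro w hw
  have hR₂ : 0 ≤ R₂ := hD.nonneg.trans h₂.le
  rw [circleIntegral.integral_congr (g := fun z => Complex.exp ((z - β i) * (h - x)) *
    (∏ k ∈ Finset.Icc (i + 1) n, (z - β k)) / (z - w)) hR₂ fun z hz => ?_]
  · refine circleIntegral_eq_zero_of_differentiable hR₂ fun z hz => ?_
    refine DifferentiableAt.div (by fun_prop) (by fun_prop) ?_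
    intro h0
    rw [sub_eq_zero.1 h0] at hz
    linarith
  · have hz' : ρ < ‖z‖ := by rwa [mem_sphere_zero_iff_norm.1 hz]
    have h3 := prod_Icc_inv_mul_prod_Icc (f := fun k => (z - β k : ℂ)) hin fun k hk1 hk2 =>
      sub_ofReal_ne_zero (hD.beta k (Finset.mem_Icc.2 ⟨hk1, by omega⟩)) hz'
    have h4 := congrArg (·⁻¹) h3
    simp only [mul_inv, inv_inv, Finset.prod_inv_distrib] at h4
    simp only [zFactor, rowFactor, ← h4]
    simp [mul_comm]

/-- The last one-time row vanishes at the threshold if there is a remaining weight. -/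
theorem InDisc.contourRow_oneTimeKernel_eq_zero (hD : InDisc α β M N ρ) {t j : ℕ} (ht : t < M)
    (hj : 1 ≤ j) (hjN : j ≤ N) (H : ℝ) {R : ℝ} (hR : ρ < R) :
    contourRow α β M R H (oneTimeKernel β j) t N H = 0 := by
  unfold contourRow
  refine circleIntegral_eq_zero_of_decay (hD.nonneg.trans_lt hR) (fun z hz => ?_) ?_
  · refine DifferentiableAt.mul (by fun_prop) ?_
    refine (hD.differentiableAt_rowFactor le_rfl le_rfl t (by linarith)).mul ?_
    unfold oneTimeKernel
    fun_prop
  -- At `x = H` at least one factor `1 / (z - β j)` and one decaying factor in `α` survive.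
  · obtain ⟨l, hl⟩ := tendsto_prod_inv_sub_cobounded (Finset.Icc (j + 1) N) β
    have h3 := tendsto_prod_div_add_cobounded (s := Finset.Icc (t + 1) M)
      ⟨t + 1, Finset.mem_Icc.2 ⟨le_rfl, ht⟩⟩ α (fun k => (α k + β N : ℂ))
    have h4 := ((hl.mul h3).mul (tendsto_mul_inv_sub_cobounded (β j))).const_mul
      (1 / (2 * π * Complex.I))
    rw [mul_zero, zero_mul, mul_zero] at h4
    refine h4.congr' ?_
    filter_upwards [eventually_cobounded_lt_norm ρ] with z hz
    have hne : ∀ k, 1 ≤ k → k ≤ N → (z - β k : ℂ) ≠ 0 := fun k hk1 hk2 =>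
      sub_ofReal_ne_zero (hD.beta k (Finset.mem_Icc.2 ⟨hk1, by omega⟩)) hz
    rw [← prod_Icc_inv_mul_prod_Icc hjN fun k hk1 hk2 => hne k hk1 (hk2.trans hjN)]
    obtain ⟨j, rfl⟩ : ∃ j', j = j' + 1 := ⟨j - 1, by omega⟩
    rw [Finset.prod_Icc_succ_top (by omega)]
    simp only [rowFactor, oneTimeKernel, sub_self, mul_zero, Complex.exp_zero,
      Nat.add_sub_cancel]
    have := hne (j + 1) hj hjN
    field_simp

/-- Without remaining weights, the one-time matrix is unitriangular. -/
theorem InDisc.contourRow_oneTimeKernel_of_le (hD : InDisc α β M N ρ) {i j : ℕ} (hi : 1 ≤ i)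
    (hij : i ≤ j) (hj : j ≤ N) (H x : ℝ) {R : ℝ} (hR : ρ < R) :
    contourRow α β M R H (oneTimeKernel β j) M i x = if i = j then 1 else 0 := by
  have hR0 : 0 ≤ R := hD.nonneg.trans hR.le
  have hne : ∀ z ∈ Metric.sphere (0 : ℂ) R, ∀ k, 1 ≤ k → k ≤ N → (z - β k : ℂ) ≠ 0 :=
    fun z hz k hk1 hk2 => sub_ofReal_ne_zero (hD.beta k (Finset.mem_Icc.2 ⟨hk1, hk2⟩))
      (by rwa [mem_sphere_zero_iff_norm.1 hz])
  unfold contourRow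
  -- On the diagonal the only pole is the simple one at `β i`, with residue `1`; above it the
  -- numerator cancels every pole.
  split_ifs with h
  · subst h
    obtain ⟨i, rfl⟩ : ∃ i', i = i' + 1 := ⟨i - 1, by omega⟩
    rw [circleIntegral.integral_congr (g := fun z => 1 / (2 * π * Complex.I) * ((z - β (i + 1))⁻¹ •
      Complex.exp ((z - β (i + 1)) * (H - x)))) hR0 fun z hz => ?_]
    · rw [circleIntegral.integral_const_mul, DifferentiableOn.circleIntegral_sub_inv_smul]
      · rw [sub_self, zero_mul, Complex.exp_zero, smul_eq_mul, mul_one, one_div,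
          inv_mul_cancel₀ Complex.two_pi_I_ne_zero]
      · fun_prop
      · rw [mem_ball_zero_iff, Complex.norm_real, Real.norm_eq_abs]
        exact (hD.beta (i + 1) (Finset.mem_Icc.2 ⟨hi, hj⟩)).trans_lt hR
    · have h1 := hne z hz (i + 1) hi hj
      have h2 : ∏ k ∈ Finset.Icc 1 i, (z - β k) ≠ 0 := Finset.prod_ne_zero_iff.2 fun k hk =>
        hne z hz k (Finset.mem_Icc.1 hk).1 (by have := (Finset.mem_Icc.1 hk).2; omega)
      simp only [rowFactor, oneTimeKernel, Nat.add_sub_cancel]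
      rw [Finset.prod_Icc_succ_top (by omega)]
      simp
      field_simp
  · rw [circleIntegral.integral_congr (g := fun z => 1 / (2 * π * Complex.I) *
      (Complex.exp ((z - β i) * (H - x)) * ∏ k ∈ Finset.Icc (i + 1) (j - 1), (z - β k)))
      hR0 fun z hz => ?_]
    · exact circleIntegral_eq_zero_of_differentiable hR0 fun z hz => by fun_prop
    · have h3 := prod_Icc_inv_mul_prod_Icc (f := fun k => (z - β k : ℂ)) (n := i) (i := j - 1)
        (by omega) fun k hk1 hk2 => hne z hz k hk1 (by omega)
      have h4 := congrArg (·⁻¹) h3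
      simp only [mul_inv, inv_inv, Finset.prod_inv_distrib] at h4
      simp only [rowFactor, oneTimeKernel, ← h4]
      simp
      ring

/-- The residue rows are the one-time rows, up to conjugation by a diagonal matrix. -/
theorem InDisc.contourRow_residueKernel_eq_oneTime (hD : InDisc α β M N ρ)
    (hαβ : ∀ i j : ℕ, 1 ≤ i → 1 ≤ j → 0 < α i + β j) {m n i t : ℕ} (htm : t ≤ m) (hm : m ≤ M)
    (hn : n ≤ N) (hi : 1 ≤ i) (j : ℕ) (h H x : ℝ) {R : ℝ} (hR : ρ < R) :
    contourRow α β m R h (residueKernel α β m n M h H j) t i x =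
      (Complex.exp (β i * (H - h)) / ∏ k ∈ Finset.Icc (m + 1) M, (α k + β i : ℂ)) *
      ((Complex.exp (β j * (H - h)) / ∏ k ∈ Finset.Icc (m + 1) M, (α k + β j : ℂ))⁻¹ *
      contourRow α β M R H (oneTimeKernel β j) t i x) := by
  unfold contourRow
  rw [← circleIntegral.integral_const_mul, ← circleIntegral.integral_const_mul]
  refine circleIntegral.integral_congr (hD.nonneg.trans hR.le) fun z hz => ?_
  have hz' : ρ < ‖z‖ := by rwa [mem_sphere_zero_iff_norm.1 hz]
  have h1 : ∏ k ∈ Finset.Icc 1 n, (z - β k) ≠ 0 := hD.prod_beta_ne_zero le_rfl hn hz'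
  have h2 : ∀ l, 1 ≤ l → ∏ k ∈ Finset.Icc (m + 1) M, (α k + β l : ℂ) ≠ 0 := by
    intro l hl
    refine Finset.prod_ne_zero_iff.2 fun k hk => ?_
    have := hαβ k l (by have := (Finset.mem_Icc.1 hk).1; omega) hl
    exact_mod_cast this.ne'
  have h3 : ∏ k ∈ Finset.Icc (t + 1) M, ((α k + β i : ℂ) / (z + α k)) =
      (∏ k ∈ Finset.Icc (t + 1) m, ((α k + β i : ℂ) / (z + α k))) *
        ∏ k ∈ Finset.Icc (m + 1) M, ((α k + β i : ℂ) / (z + α k)) := by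
    have : Finset.Icc (t + 1) M = Finset.Icc (t + 1) m ∪ Finset.Icc (m + 1) M := by
      ext k; simp only [Finset.mem_union, Finset.mem_Icc]; omega
    rw [this, Finset.prod_union]
    rw [Finset.disjoint_left]
    intro k hk
    simp only [Finset.mem_Icc] at hk ⊢
    omega
  -- The `w`-exponential at `w = z` moves the threshold from `h` to `H`, at the cost of a constant
  -- `exp((β i - β j)(H - h))`.
  have h4 : Complex.exp ((z - β i) * (h - x)) * Complex.exp ((z - β j) * (H - h)) =
      Complex.exp (β i * (H - h)) * ((Complex.exp (β j * (H - h)))⁻¹ *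
        Complex.exp ((z - β i) * (H - x))) := by
    rw [← Complex.exp_neg, ← Complex.exp_add, ← Complex.exp_add, ← Complex.exp_add]
    congr 1; ring
  have h5 := h2 i hi
  simp only [rowFactor, residueKernel, wFactor, oneTimeKernel, h3]
  simp only [Finset.prod_div_distrib]
  set Pα := ∏ k ∈ Finset.Icc (m + 1) M, (z + (α k : ℂ))
  have h7 : ∀ a b c d e f g p q u v : ℂ, v ≠ 0 → p ≠ 0 → a * b = c * (d⁻¹ * e) →
      a * (g⁻¹ * f * (1 / (2 * π * Complex.I) * (p * (b * (q / p) * (u / Pα))))) =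
      c / v * ((d / u)⁻¹ * (e * (g⁻¹ * (f * (v / Pα)) * (1 / (2 * π * Complex.I) * q)))) := by
    intro a b c d e f g p q u v hv hp habc
    calc _ = a * b * (g⁻¹ * f * (1 / (2 * π * Complex.I) * ((p / p) * q * (u / Pα)))) := by ring
      _ = _ := by
        rw [habc, div_self hp, inv_div]
        field_simp
  exact h7 _ _ _ _ _ _ _ _ _ _ _ h5 h1 h4

end Entries

/-! ### Truncation of a row beyond its threshold. -/

section Cut

variable {V : Type*} [NormedAddCommGroup V]

open Classical in
/-- The function `f`, replaced by `0` on `[a, ∞)` if the condition `c` holds. -/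
noncomputable def cutOff (c : Prop) (a : ℝ) (f : ℝ → V) (x : ℝ) : V :=
  if c ∧ a ≤ x then 0 else f x

theorem cutOff_eq_zero {c : Prop} {a x : ℝ} (f : ℝ → V) (hc : c) (hx : a ≤ x) :
    cutOff c a f x = 0 := if_pos ⟨hc, hx⟩

theorem cutOff_of_not {c : Prop} {a x : ℝ} (f : ℝ → V) (h : ¬ (c ∧ a ≤ x)) :
    cutOff c a f x = f x := if_neg h

theorem cutOff_of_le {c : Prop} {a x : ℝ} {f : ℝ → V} (hf : c → f a = 0) (hx : x ≤ a) :
    cutOff c a f x = f x := by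
  unfold cutOff
  split_ifs with h
  · rw [le_antisymm hx h.2, hf h.1]
  · rfl

theorem continuous_cutOff {c : Prop} {a : ℝ} {f : ℝ → V} (hf : Continuous f) (h0 : c → f a = 0) :
    Continuous (cutOff c a f) := by
  classical
  by_cases hc : c
  · have : cutOff c a f = fun x => if a ≤ x then 0 else f x := by
      ext x; simp [cutOff, hc]
    rw [this]
    refine Continuous.if_le continuous_const hf continuous_const continuous_id fun x hx => ?_
    rw [← hx, h0 hc]
  · have : cutOff c a f = f := by ext x; simp [cutOff, hc]
    rwa [this]

open Classical in
theorem hasDerivAt_cutOff [NormedSpace ℝ V] {c : Prop} {a x : ℝ} {f : ℝ → V} {f' : V}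
    (hf : HasDerivAt f f' x) (hx : x ≠ a) :
    HasDerivAt (cutOff c a f) (if c ∧ a ≤ x then 0 else f') x := by
  split_ifs with h
  · refine (hasDerivAt_const x (0 : V)).congr_of_eventuallyEq ?_
    filter_upwards [eventually_gt_nhds (lt_of_le_of_ne h.2 hx.symm)] with t ht
    exact cutOff_eq_zero f h.1 ht.le
  · by_cases hc : c
    · have : x < a := by
        by_contra h'
        exact h ⟨hc, not_lt.1 h'⟩
      refine hf.congr_of_eventuallyEq ?_
      filter_upwards [eventually_lt_nhds this] with t ht
      exact cutOff_of_not f fun h' => absurd h'.2 (not_le.2 ht)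
    · refine hf.congr_of_eventuallyEq ?_
      filter_upwards with t
      exact cutOff_of_not f fun h' => hc h'.1

end Cut

/-! ### The recursion for the one-time and two-time rows, and their boundary values. -/

section Steps

/-- The vector of the contour integrals of one row. -/
noncomputable def rowVec (α β : ℕ → ℝ) (m N : ℕ) (R h : ℝ) (K : ℕ → ℂ → ℂ) (t i : ℕ) (x : ℝ) :
    Fin N → ℂ :=
  fun j => contourRow α β m R h (K (j + 1)) t i x

variable {α β : ℕ → ℝ} {M N : ℕ} {ρ : ℝ}

theorem InDisc.hasDerivAt_rowVec_self (hD : InDisc α β M N ρ) {m i t : ℕ} (hm : m ≤ M)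
    (hi : i ≤ N) (ht : t < m) {R : ℝ} (hR : ρ < R) {K : ℕ → ℂ → ℂ}
    (hK : ∀ j, ContinuousOn (K j) (Metric.sphere 0 R)) (h x : ℝ) :
    HasDerivAt (rowVec α β m N R h K t i) ((α (t + 1) + β i) •
      (rowVec α β m N R h K t i x - rowVec α β m N R h K (t + 1) i x)) x := by
  refine hasDerivAt_pi.2 fun j => ?_
  refine (hD.hasDerivAt_contourRow_self hm hi ht hR (hK (j + 1)) h x).congr_deriv ?_
  simp [rowVec]

theorem InDisc.continuous_rowVec (hD : InDisc α β M N ρ) {m i : ℕ} (hm : m ≤ M)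
    (hi : i ≤ N) (t : ℕ) {R : ℝ} (hR : ρ < R) {K : ℕ → ℂ → ℂ}
    (hK : ∀ j, ContinuousOn (K j) (Metric.sphere 0 R)) (h : ℝ) :
    Continuous (rowVec α β m N R h K t i) :=
  continuous_pi fun j => continuous_iff_continuousAt.2 fun x =>
    (hD.hasDerivAt_contourRow hm hi t hR (hK (j + 1)) h x).continuousAt

theorem InDisc.hasDerivAt_rowVec_pred (hD : InDisc α β M N ρ)
    (hαβ : ∀ i j : ℕ, 1 ≤ i → 1 ≤ j → 0 < α i + β j) {m l : ℕ} (hm : m ≤ M) (hl : 1 ≤ l)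
    (hlN : l + 1 ≤ N) (t : ℕ) {R : ℝ} (hR : ρ < R) (h x : ℝ) :
    ∃ c : ℂ, ∀ K : ℕ → ℂ → ℂ, (∀ j, ContinuousOn (K j) (Metric.sphere 0 R)) →
      HasDerivAt (rowVec α β m N R h K t (l + 1)) (c • rowVec α β m N R h K t l x) x := by
  obtain ⟨c, hc⟩ := hD.hasDerivAt_contourRow_pred hαβ hm hl hlN t hR h x
  exact ⟨c, fun K hK => hasDerivAt_pi.2 fun j => (hc _ (hK (j + 1))).congr_deriv (by simp [rowVec])⟩

/-- The rows of the one-time determinant. -/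
noncomputable def oneTimeRow (α β : ℕ → ℝ) (M N : ℕ) (R H : ℝ) (t : ℕ) (k : Fin N) :
    ℝ → Fin N → ℂ :=
  cutOff ((k : ℕ) + 1 = N) H (rowVec α β M N R H (oneTimeKernel β) t (k + 1))

/-- The pairs of rows of the two-time form. -/
noncomputable def twoTimeRow (α β : ℕ → ℝ) (m n M N : ℕ) (R₁ R₂ h H : ℝ) (t : ℕ) (k : Fin N)
    (x : ℝ) : (Fin N → ℂ) × (Fin N → ℂ) :=
  (cutOff (n ≤ (k : ℕ) + 1) h (rowVec α β m N R₁ h (doubleKernel α β m n M h H R₂) t (k + 1)) x,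
    cutOff ((k : ℕ) + 1 = N) H (rowVec α β m N R₁ h (residueKernel α β m n M h H) t (k + 1)) x)

theorem InDisc.oneTimeRow_last_eq_zero (hD : InDisc α β M N ρ) {t : ℕ} (ht : t < M) (H : ℝ)
    {R : ℝ} (hR : ρ < R) : rowVec α β M N R H (oneTimeKernel β) t N H = 0 := by
  ext j
  exact hD.contourRow_oneTimeKernel_eq_zero ht (by omega) j.2 H hR

/-- Only the last row is cut. It vanishes at `H` as long as a weight remains, so the cut is
continuous, and beyond `H` it makes the determinant zero. -/
theorem InDisc.isRowStep_oneTime (hD : InDisc α β M N ρ)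
    (hαβ : ∀ i j : ℕ, 1 ≤ i → 1 ≤ j → 0 < α i + β j) {t : ℕ} (ht : t < M) (H : ℝ) {R : ℝ}
    (hR : ρ < R) :
    IsRowStep (detForm N) (oneTimeRow α β M N R H (t + 1)) (oneTimeRow α β M N R H t)
      (fun j => α (t + 1) + β j) (fun _ => H) {H} where
  countable := Set.countable_singleton H
  pos := fun j hj => hαβ _ _ (by omega) hj
  cont := by
    intro k
    refine continuous_cutOff (hD.continuous_rowVec le_rfl k.2 t hR
      (fun j => (continuous_oneTimeKernel β j).continuousOn) H) fun hk => ?_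
    rw [hk]
    exact hD.oneTimeRow_last_eq_zero ht H hR
  deriv_self := by
    intro p y hy hyS
    have h1 := hD.hasDerivAt_rowVec_self (K := oneTimeKernel β) le_rfl (i := (p : ℕ) + 1) p.2 ht hR
      (fun j => (continuous_oneTimeKernel β j).continuousOn) H y
    have hn : ¬ ((p : ℕ) + 1 = N ∧ H ≤ y) := fun h' => absurd h'.2 (not_le.2 hy)
    refine (hasDerivAt_cutOff h1 hy.ne).congr_deriv ?_
    rw [if_neg hn, oneTimeRow, oneTimeRow, cutOff_of_not _ hn, cutOff_of_not _ hn]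
  deriv_pred := by
    intro p k l _ hlk y hy hyS
    obtain ⟨c, hc⟩ := hD.hasDerivAt_rowVec_pred hαβ le_rfl (l := (l : ℕ) + 1) (by omega)
      (by have := k.2; omega) t hR H y
    have h1 := hc (oneTimeKernel β) (fun j => (continuous_oneTimeKernel β j).continuousOn)
    refine ⟨c, ?_⟩
    have hn : ∀ q : Fin N, ¬ ((q : ℕ) + 1 = N ∧ H ≤ y) := fun q h' => absurd h'.2 (not_le.2 hy)
    unfold oneTimeRow
    rw [← hlk]
    refine (hasDerivAt_cutOff h1 hy.ne).congr_deriv ?_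
    rw [cutOff_of_not _ (hn l), if_neg fun h' => absurd h'.2 (not_le.2 hy)]
  zero := by
    intro p r hr
    have hpN := p.2
    set q : Fin N := ⟨N - 1, by omega⟩ with hq
    have hq1 : (q : ℕ) + 1 = N := by simp [hq]; omega
    obtain ⟨y, hy, h1⟩ := hr q (by rw [Fin.le_def]; simp [hq]; omega)
    refine (detForm N).map_coord_zero q ?_
    rcases h1 with h1 | h1 <;> rw [h1] <;> exact cutOff_eq_zero _ hq1 hy

theorem InDisc.rowVec_residue_eq_oneTime (hD : InDisc α β M N ρ)
    (hαβ : ∀ i j : ℕ, 1 ≤ i → 1 ≤ j → 0 < α i + β j) {m n i t : ℕ} (htm : t ≤ m) (hm : m ≤ M)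
    (hn : n ≤ N) (hi : 1 ≤ i) (h H x : ℝ) {R : ℝ} (hR : ρ < R) :
    rowVec α β m N R h (residueKernel α β m n M h H) t i x = fun j : Fin N =>
      (Complex.exp (β i * (H - h)) / ∏ k ∈ Finset.Icc (m + 1) M, (α k + β i : ℂ)) *
      ((Complex.exp (β (j + 1) * (H - h)) / ∏ k ∈ Finset.Icc (m + 1) M, (α k + β (j + 1) : ℂ))⁻¹ *
      rowVec α β M N R H (oneTimeKernel β) t i x j) := by
  ext j
  exact hD.contourRow_residueKernel_eq_oneTime hαβ htm hm hn hi (j + 1) h H x hR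

theorem InDisc.rowVec_residue_last_eq_zero (hD : InDisc α β M N ρ)
    (hαβ : ∀ i j : ℕ, 1 ≤ i → 1 ≤ j → 0 < α i + β j) {m n t : ℕ} (htm : t ≤ m) (hm : m < M)
    (hn : n ≤ N) (hN : 1 ≤ N) (h H : ℝ) {R : ℝ} (hR : ρ < R) :
    rowVec α β m N R h (residueKernel α β m n M h H) t N H = 0 := by
  rw [hD.rowVec_residue_eq_oneTime hαβ htm hm.le hn hN h H H hR,
    hD.oneTimeRow_last_eq_zero (by omega) H hR]
  ext j
  simp

theorem InDisc.rowVec_double_eq_zero (hD : InDisc α β M N ρ) {m n i t : ℕ} (hm : m ≤ M)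
    (hni : n ≤ i) (hi : i ≤ N) (ht : t < m) (h H : ℝ) {R₁ R₂ : ℝ} (h₂ : ρ < R₂)
    (h₁ : R₂ < R₁) : rowVec α β m N R₁ h (doubleKernel α β m n M h H R₂) t i h = 0 := by
  ext j
  exact hD.contourRow_doubleKernel_eq_zero hm hni hi ht h H _ h₂ h₁

/-- The level depends on the column. Above `h`, row `n` has its first component cut but row `n - 1`
does not, so the relation between neighbours would fail; but once all rows from some `p ≤ n` on are
beyond `h`, the form vanishes by the degree argument, and such columns need not be followed past
`h`. For later columns both neighbours are cut alike, and the relation holds up to `H`, where the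
last pair vanishes. Continuity is asked only before the step, when a weight is left; the rows at
time `m` may jump. -/
theorem InDisc.isRowStep_twoTime (hD : InDisc α β M N ρ)
    (hαβ : ∀ i j : ℕ, 1 ≤ i → 1 ≤ j → 0 < α i + β j) {m n t : ℕ} (ht : t < m) (hm : m < M)
    (hn : 1 ≤ n) (hnN : n < N) {h H : ℝ} (hhH : h ≤ H) {R₁ R₂ r : ℝ} (h₂ : ρ < R₂)
    (h₁ : R₂ < R₁) (hr : 1 < r) :
    IsRowStep (twoTimeForm n N r) (twoTimeRow α β m n M N R₁ R₂ h H (t + 1))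
      (twoTimeRow α β m n M N R₁ R₂ h H t)
      (fun j => α (t + 1) + β j) (fun p => if (p : ℕ) + 1 ≤ n then h else H) {h, H} := by
  have hR₁ := h₂.trans h₁
  have hKU : ∀ j, ContinuousOn (doubleKernel α β m n M h H R₂ j) (Metric.sphere 0 R₁) :=
    fun j => hD.continuousOn_doubleKernel hnN.le m h H j h₂ h₁
  have hKD : ∀ j, ContinuousOn (residueKernel α β m n M h H j) (Metric.sphere 0 R₁) :=
    fun j => hD.continuousOn_residueKernel hnN.le m h H j hR₁
  have hB : ∀ p : Fin N, (if (p : ℕ) + 1 ≤ n then h else H) ≤ H := by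
    intro p; split_ifs <;> simp [hhH]
  refine ⟨(Set.countable_singleton H).insert h, fun j hj => hαβ _ _ (by omega) hj, ?_, ?_, ?_, ?_⟩
  · intro k
    refine (continuous_cutOff (hD.continuous_rowVec hm.le k.2 t hR₁ hKU h) fun hk => ?_).prodMk
      (continuous_cutOff (hD.continuous_rowVec hm.le k.2 t hR₁ hKD h) fun hk => ?_)
    · exact hD.rowVec_double_eq_zero hm.le hk k.2 ht h H h₂ h₁
    · rw [hk]
      exact hD.rowVec_residue_last_eq_zero hαβ ht.le hm hnN.le (by omega) h H hR₁
  · intro p y hy hyS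
    simp only [Set.mem_insert_iff, Set.mem_singleton_iff, not_or] at hyS
    have h1 := hD.hasDerivAt_rowVec_self hm.le (i := (p : ℕ) + 1) p.2 ht hR₁ hKU h y
    have h2 := hD.hasDerivAt_rowVec_self hm.le (i := (p : ℕ) + 1) p.2 ht hR₁ hKD h y
    refine ((hasDerivAt_cutOff (c := n ≤ (p : ℕ) + 1) h1 hyS.1).prodMk
      (hasDerivAt_cutOff (c := (p : ℕ) + 1 = N) h2 hyS.2)).congr_deriv ?_
    simp only [twoTimeRow, cutOff]
    ext1
    · split_ifs <;> simp
    · split_ifs <;> simp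
  · intro p k l hpl hlk y hy hyS
    simp only [Set.mem_insert_iff, Set.mem_singleton_iff, not_or] at hyS
    obtain ⟨c, hc⟩ := hD.hasDerivAt_rowVec_pred hαβ hm.le (l := (l : ℕ) + 1) (by omega)
      (by have := k.2; omega) t hR₁ h y
    refine ⟨c, ?_⟩
    have hyH : ¬ H ≤ y := not_le.2 (hy.trans_le (hB p))
    have hpl' : (p : ℕ) ≤ l := hpl
    have h1 := hasDerivAt_cutOff (c := n ≤ (k : ℕ) + 1) (hc _ hKU) hyS.1
    have h2 := hasDerivAt_cutOff (c := (k : ℕ) + 1 = N) (hc _ hKD) hyS.2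
    rw [hlk] at h1 h2
    refine (h1.prodMk h2).congr_deriv ?_
    simp only [twoTimeRow, cutOff, hyH, and_false, if_false, hlk]
    ext1
    -- Below `h` nothing is cut; otherwise `p` is past column `n`, so rows `k` and `l` are both
    -- subject to the cut at `h`.
    · by_cases hp : (p : ℕ) + 1 ≤ n
      · rw [if_pos hp] at hy
        simp [not_le.2 hy]
      · have e1 : n ≤ (k : ℕ) + 1 := by omega
        have e2 : n ≤ (k : ℕ) := by omega
        simp only [e1, e2, true_and]
        split_ifs <;> simp
    · simp
  · intro p v hv
    by_cases hp : (p : ℕ) + 1 ≤ n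
    · simp only [hp, if_true] at hv
      refine twoTimeForm_eq_zero hr hn fun i hi => ?_
      obtain ⟨y, hy, h1⟩ := hv i (by rw [Fin.le_def]; omega)
      rcases h1 with h1 | h1 <;> rw [h1] <;> exact cutOff_eq_zero _ hi hy
    · simp only [hp, if_false] at hv
      set q : Fin N := ⟨N - 1, by omega⟩ with hq
      have hq1 : (q : ℕ) + 1 = N := by simp [hq]; omega
      obtain ⟨y, hy, h1⟩ := hv q (by have := p.2; rw [Fin.le_def]; simp [hq]; omega)
      refine (twoTimeForm n N r).map_coord_zero q ?_
      rcases h1 with h1 | h1 <;> rw [h1] <;>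
        exact Prod.ext (cutOff_eq_zero _ (by omega) (hhH.trans hy)) (cutOff_eq_zero _ hq1 hy)

/-- The one-time determinant without remaining weights is the indicator of `s N < H`. -/
theorem InDisc.detForm_oneTimeRow (hD : InDisc α β M N ρ) (hN : 1 ≤ N) (H : ℝ) {R : ℝ}
    (hR : ρ < R) (s : ℕ → ℝ) :
    (({s : ℕ → ℝ | s N < H}.indicator (1 : (ℕ → ℝ) → ENNReal) s).toReal : ℂ) =
      detForm N fun k => oneTimeRow α β M N R H M k (s ((k : ℕ) + 1)) := by
  by_cases hs : s N < H
  · have h1 : (fun k : Fin N => oneTimeRow α β M N R H M k (s ((k : ℕ) + 1))) = fun k : Fin N =>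
        rowVec α β M N R H (oneTimeKernel β) M (k + 1) (s ((k : ℕ) + 1)) := by
      ext1 k
      refine cutOff_of_not _ ?_
      rintro ⟨h1, h2⟩
      rw [h1] at h2
      exact absurd h2 (not_le.2 hs)
    rw [h1, detForm_apply, Matrix.det_of_isLowerTriangular, Finset.prod_eq_one]
    · simp [hs]
    · intro k _
      rw [Matrix.of_apply, rowVec, hD.contourRow_oneTimeKernel_of_le (by omega) le_rfl k.2 H _ hR,
        if_pos rfl]
    · intro i j hij
      have hij' : (i : ℕ) < j := hij
      rw [Matrix.of_apply, rowVec, hD.contourRow_oneTimeKernel_of_le (by omega) (by omega) j.2 H _ hR,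
        if_neg (by omega)]
  · set q : Fin N := ⟨N - 1, by omega⟩ with hq
    have hq1 : (q : ℕ) + 1 = N := by simp [hq]; omega
    rw [(detForm N).map_coord_zero q]
    · simp [hs]
    · exact cutOff_eq_zero _ hq1 (by rw [hq1]; exact not_lt.1 hs)

/-- At the first time, the two-time form is the one-time determinant restricted to `s n < h`. -/
theorem InDisc.twoTimeForm_twoTimeRow (hD : InDisc α β M N ρ)
    (hαβ : ∀ i j : ℕ, 1 ≤ i → 1 ≤ j → 0 < α i + β j) {m n : ℕ} (hm : m ≤ M)
    (hn : 1 ≤ n) (hnN : n < N) (h H : ℝ) {R₁ R₂ r : ℝ} (h₂ : ρ < R₂)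
    (h₁ : R₂ < R₁) (hr : 1 < r) (s : ℕ → ℝ) (hs : MonotoneOn s (Set.Icc 0 N)) :
    (twoTimeForm n N r fun k => twoTimeRow α β m n M N R₁ R₂ h H m k (s ((k : ℕ) + 1))) =
      if s n < h then detForm N fun k => oneTimeRow α β M N R₁ H m k (s ((k : ℕ) + 1)) else 0 := by
  have hR₁ := h₂.trans h₁
  split_ifs with hsn
  · rw [twoTimeForm_eq_det hr hnN.le]
    -- The second components are one-time rows conjugated by the diagonal matrix `u`, which leaves
    -- the determinant unchanged.
    · set u : Fin N → ℂ := fun k => Complex.exp (β (k + 1) * (H - h)) /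
        ∏ l ∈ Finset.Icc (m + 1) M, (α l + β (k + 1) : ℂ) with hu
      have hu0 : ∀ k, u k ≠ 0 := by
        intro k
        refine div_ne_zero (Complex.exp_ne_zero _) (Finset.prod_ne_zero_iff.2 fun l hl => ?_)
        have := hαβ l (k + 1) (by have := (Finset.mem_Icc.1 hl).1; omega) (by omega)
        exact_mod_cast this.ne'
      have h3 : (fun k : Fin N => (twoTimeRow α β m n M N R₁ R₂ h H m k (s ((k : ℕ) + 1))).2) =
          Matrix.of fun k j => u k * Matrix.of (fun k j => (u j)⁻¹ *
            oneTimeRow α β M N R₁ H m k (s ((k : ℕ) + 1)) j) k j := by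
        ext k j
        simp only [twoTimeRow, Matrix.of_apply, oneTimeRow, cutOff]
        split_ifs
        · simp
        · rw [hD.rowVec_residue_eq_oneTime hαβ le_rfl hm hnN.le (by omega) h H _ hR₁]
      have h4 : detForm N (Matrix.of fun k j => u k * Matrix.of (fun k j => (u j)⁻¹ *
            oneTimeRow α β M N R₁ H m k (s ((k : ℕ) + 1)) j) k j) =
          (∏ k, u k) * ((∏ k, (u k)⁻¹) *
            (Matrix.of fun k j => oneTimeRow α β M N R₁ H m k (s ((k : ℕ) + 1)) j).det) := by
        rw [← Matrix.det_mul_row, ← Matrix.det_mul_column]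
        rfl
      rw [h3, h4, ← mul_assoc, ← Finset.prod_mul_distrib,
        Finset.prod_eq_one fun k _ => mul_inv_cancel₀ (hu0 k), one_mul]
      rfl
    · intro k hk
      have hk1 : s (k + 1) < h := (hs ⟨by omega, by omega⟩ ⟨by omega, hnN.le⟩ (by omega)).trans_lt hsn
      simp only [twoTimeRow]
      rw [cutOff_of_not _ fun h' => absurd h'.2 (not_le.2 hk1),
        cutOff_of_not _ fun h' => absurd h'.1 (by omega)]
      ext j
      exact hD.contourRow_doubleKernel_eq_residue hm (by omega) hnN.le h H _ _ h₂ h₁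
  -- By monotonicity every coordinate from `n` on is at least `h`, so all first components from row
  -- `n` on are cut to zero.
  · refine twoTimeForm_eq_zero hr hn fun k hk => cutOff_eq_zero _ hk ?_
    exact (not_lt.1 hsn).trans (hs ⟨by omega, hnN.le⟩ ⟨by omega, k.2⟩ hk)

/-- At time zero, the rows of the two-time form are those of `L₁` and `L₁ - L₂`. -/
theorem InDisc.twoTimeRow_zero (hD : InDisc α β M N ρ)
    (hαβ : ∀ i j : ℕ, 1 ≤ i → 1 ≤ j → 0 < α i + β j) {m n : ℕ} (hm1 : 1 ≤ m) (hm : m < M)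
    (hnN : n < N) {h H : ℝ} (hhH : h ≤ H) (x : ℕ → ℝ) {R₁ R₂ R₁' R₂' : ℝ} (h₂ : ρ < R₂)
    (h₁ : R₂ < R₁) (h₁' : ρ < R₁') (h₂' : R₁' < R₂') (k : Fin N) (hx : x (k + 1) ≤ h) :
    twoTimeRow α β m n M N R₁ R₂ h H 0 k (x (k + 1)) =
      (fun j => twoTimeMatrix α β x m n M N h H R₁ R₂ k j,
        fun j => twoTimeMatrix α β x m n M N h H R₁ R₂ k j -
          twoTimeMatrix α β x m n M N h H R₁' R₂' k j) := by
  have hR₁ := h₂.trans h₁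
  unfold twoTimeRow
  -- The starting points lie at or below both thresholds and the rows vanish at their thresholds, so
  -- the cuts are invisible at time zero.
  rw [cutOff_of_le (fun hk => hD.rowVec_double_eq_zero hm.le hk k.2 (by omega) h H h₂ h₁) hx,
    cutOff_of_le (fun hk => ?_) (hx.trans hhH)]
  · refine Prod.ext (funext fun j => ?_) (funext fun j => ?_)
    · exact (contourRow_doubleKernel α β m n M h H R₁ R₂ 0 (k + 1) (j + 1) (x (k + 1))).trans
        (twoTimeMatrix_eq α β x m n M N h H R₁ R₂ k j).symm
    · have h3 := hD.sub_eq_contourRow_residueKernel hm.le hnN.le k.2 0 (j + 1) h H (x (k + 1))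
        h₂ h₁ h₁' h₂' hR₁
      rw [← twoTimeMatrix_eq α β x m n M N h H R₁ R₂ k j,
        ← twoTimeMatrix_eq α β x m n M N h H R₁' R₂' k j] at h3
      exact h3.symm
  · rw [hk]
    exact hD.rowVec_residue_last_eq_zero hαβ (by omega) hm hnN.le (by omega) h H hR₁

end Steps

/-! ### A common disc for the parameters, and the conclusion. -/

theorem exists_abs_le_of_lt {s : Finset ℕ} {f : ℕ → ℝ} {T : ℝ} (hT : 0 < T)
    (hf : ∀ k ∈ s, |f k| < T) : ∃ ρ, 0 ≤ ρ ∧ ρ < T ∧ ∀ k ∈ s, |f k| ≤ ρ := by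
  induction s using Finset.induction_on with
  | empty => exact ⟨0, le_rfl, hT, by simp⟩
  | insert a s _ ih =>
    obtain ⟨ρ, h0, h1, h2⟩ := ih fun k hk => hf k (Finset.mem_insert_of_mem hk)
    refine ⟨max ρ |f a|, h0.trans (le_max_left _ _), max_lt h1 (hf a (Finset.mem_insert_self _ _)),
      fun k hk => ?_⟩
    rcases Finset.mem_insert.1 hk with rfl | hk
    · exact le_max_right _ _
    · exact (h2 k hk).trans (le_max_left _ _)

/-- One-sided bounds suffice: `α k > -β 1 > -T` and `β k > -α 1 > -T` by positivity of the rates.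
Hence all poles lie strictly inside the circle of radius `T`. -/
theorem exists_inDisc {α β : ℕ → ℝ} (hαβ : ∀ i j : ℕ, 1 ≤ i → 1 ≤ j → 0 < α i + β j) {M N : ℕ}
    (hM : 1 ≤ M) (hN : 1 ≤ N) {T : ℝ} (hα : ∀ k ∈ Finset.Icc 1 M, α k < T)
    (hβ : ∀ k ∈ Finset.Icc 1 N, β k < T) : ∃ ρ, ρ < T ∧ InDisc α β M N ρ := by
  have hM1 : 1 ∈ Finset.Icc 1 M := Finset.mem_Icc.2 ⟨le_rfl, hM⟩
  have hN1 : 1 ∈ Finset.Icc 1 N := Finset.mem_Icc.2 ⟨le_rfl, hN⟩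
  have hT : 0 < T := by
    have := hαβ 1 1 le_rfl le_rfl
    have := hα 1 hM1
    have := hβ 1 hN1
    linarith
  obtain ⟨ρ₁, h1, h2, h3⟩ := exists_abs_le_of_lt hT fun k hk => abs_lt.2
    ⟨by linarith [hαβ k 1 (Finset.mem_Icc.1 hk).1 le_rfl, hβ 1 hN1], hα k hk⟩
  obtain ⟨ρ₂, h4, h5, h6⟩ := exists_abs_le_of_lt hT fun k hk => abs_lt.2
    ⟨by linarith [hαβ 1 k le_rfl (Finset.mem_Icc.1 hk).1, hα 1 hM1], hβ k hk⟩
  exact ⟨max ρ₁ ρ₂, max_lt h2 h5, h1.trans (le_max_left _ _),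
    fun k hk => (h3 k hk).trans (le_max_left _ _), fun k hk => (h6 k hk).trans (le_max_right _ _)⟩

theorem mainTheorem8
    {Ω : Type*} [MeasurableSpace Ω] (P : Measure Ω) [IsProbabilityMeasure P]
    (α β : ℕ → ℝ) (hαβ : ∀ i j : ℕ, 1 ≤ i → 1 ≤ j → 0 < α i + β j)
    (ω : ℕ → ℕ → Ω → ℝ)
    (hlaw : ∀ i j : ℕ, 1 ≤ i → 1 ≤ j → HasLaw (ω i j) (expMeasure (α i + β j)) P)
    (hindep : iIndepFun (fun p : ℕ+ × ℕ+ => ω p.1 p.2) P)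
    (m n M N : ℕ) (hm : 1 ≤ m) (hn : 1 ≤ n) (hmM : m < M) (hnN : n < N)
    (x : ℕ → ℝ) (hx : MonotoneOn x (Set.Icc 1 N))
    (c : ℝ) (hc : c ≤ x 1)
    (h H : ℝ) (hxh : x N ≤ h) (hhH : h ≤ H)
    (r : ℝ) (hr : 1 < r)
    (R₁ R₂ R₁' R₂' : ℝ)
    (hR : R₂ < R₁) (hRα : ∀ k ∈ Finset.Icc 1 M, α k < R₂) (hRβ : ∀ k ∈ Finset.Icc 1 N, β k < R₂)
    (hR' : R₁' < R₂') (hRα' : ∀ k ∈ Finset.Icc 1 M, α k < R₁')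
    (hRβ' : ∀ k ∈ Finset.Icc 1 N, β k < R₁') :
    ((P.real {s | growth c x (fun i j => ω i j s) m n < h ∧
        growth c x (fun i j => ω i j s) M N < H} : ℝ) : ℂ) =
      1 / (2 * π * Complex.I) * ∮ θ in C(0, r),
        (thetaCombination n N (twoTimeMatrix α β x m n M N h H R₁ R₂)
          (twoTimeMatrix α β x m n M N h H R₁' R₂') θ).det / (θ - 1) := by
  obtain ⟨ρ, hρ, hD⟩ := exists_inDisc hαβ (by omega : 1 ≤ M) (by omega : 1 ≤ N)
    (T := min R₂ R₁') (fun k hk => lt_min (hRα k hk) (hRα' k hk))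
    (fun k hk => lt_min (hRβ k hk) (hRβ' k hk))
  have h₂ : ρ < R₂ := hρ.trans_le (min_le_left _ _)
  have h₁' : ρ < R₁' := hρ.trans_le (min_le_right _ _)
  set f₂ : (ℕ → ℝ) → ENNReal := {s : ℕ → ℝ | s N < H}.indicator 1 with hf₂
  have hf₂m : Measurable f₂ :=
    measurable_one.indicator (measurableSet_lt (measurable_pi_apply N) measurable_const)
  have hf₂1 : ∀ s, f₂ s ≤ 1 := fun s => Set.indicator_le_self' (fun _ _ => zero_le) s
  set g : (ℕ → ℝ) → ENNReal := rowsOp α β N m (M - m) f₂ with hg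
  have hg1 : ∀ s, g s ≤ 1 := rowsOp_le_one hαβ m (M - m) hf₂1
  have hgΛ : ∀ s, MonotoneOn s (Set.Icc 0 N) →
      ((g s).toReal : ℂ) = detForm N fun k => oneTimeRow α β M N R₁ H m k (s ((k : ℕ) + 1)) := by
    refine rowsOp_eq hαβ (B := fun _ => H) (S := {H}) (fun u hu1 hu2 =>
      hD.isRowStep_oneTime hαβ (by omega) H (h₂.trans hR)) hf₂m hf₂1 fun s _ => ?_
    rw [Nat.add_sub_cancel' hmM.le]
    exact hD.detForm_oneTimeRow (by omega) H (h₂.trans hR) s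
  set f₁ : (ℕ → ℝ) → ENNReal := fun s => {s : ℕ → ℝ | s n < h}.indicator 1 s * g s with hf₁
  have hf₁m : Measurable f₁ :=
    (measurable_one.indicator (measurableSet_lt (measurable_pi_apply n) measurable_const)).mul
      (measurable_rowsOp hαβ N m (M - m) hf₂m)
  have hf₁1 : ∀ s, f₁ s ≤ 1 := fun s =>
    mul_le_one' (Set.indicator_le_self' (fun _ _ => zero_le) s) (hg1 s)
  have hf₁Λ : ∀ s, MonotoneOn s (Set.Icc 0 N) → ((f₁ s).toReal : ℂ) =
      twoTimeForm n N r fun k => twoTimeRow α β m n M N R₁ R₂ h H m k (s ((k : ℕ) + 1)) := by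
    intro s hs
    rw [hD.twoTimeForm_twoTimeRow hαβ hmM.le hn hnN h H h₂ hR hr s hs, ← hgΛ s hs]
    by_cases hsn : s n < h <;> simp [hf₁, hsn]
  set s₀ : ℕ → ℝ := growthFrontier c x (fun _ _ => 0) N 0 0 with hs₀
  have hs₀x : ∀ k, 1 ≤ k → k ≤ N → s₀ k = x k := by
    intro k hk1 hk2
    have : ¬ k ≤ 0 := by omega
    simp [hs₀, growthFrontier, this, hk2, growth]
  have hs₀m : MonotoneOn s₀ (Set.Icc 0 N) := by
    intro a ha b hb hab
    simp only [Set.mem_Icc] at ha hb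
    rcases Nat.eq_zero_or_pos a with rfl | ha0
    -- Coordinate `0` of the frontier already belongs to row `1`, so it equals `c` and not `x 0`;
    -- this is where `c ≤ x 1` makes the initial state monotone.
    · have h0 : s₀ 0 = c := by simp [hs₀, growthFrontier, growth]
      rcases Nat.eq_zero_or_pos b with rfl | hb0
      · exact le_rfl
      · rw [h0, hs₀x b hb0 hb.2]
        exact hc.trans (hx ⟨le_rfl, by omega⟩ ⟨hb0, hb.2⟩ hb0)
    · rw [hs₀x a ha0 ha.2, hs₀x b (by omega) hb.2]
      exact hx ⟨ha0, ha.2⟩ ⟨by omega, hb.2⟩ hab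
  -- The second recursion starts where the one-time recursion ended: `f₁` is the one-time
  -- determinant at time `m` times the indicator of `s n < h`.
  have key := rowsOp_eq hαβ (t := 0) (l := m) (Λ := twoTimeForm n N r)
    (ρ := twoTimeRow α β m n M N R₁ R₂ h H)
    (fun u _ hu => hD.isRowStep_twoTime hαβ (by omega) hmM hn hnN hhH h₂ hR hr) hf₁m hf₁1
    (by rw [zero_add]; exact hf₁Λ) s₀ hs₀m
  have hP := measure_growth_lt_and_growth_lt hαβ hlaw hindep c x hn hmM.le hnN.le h H
  rw [measureReal_def, hP, key, ← twoTimeForm_eq_thetaCombination hr hnN.le]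
  congr 1
  ext1 k
  have hk : x (k + 1) ≤ h := (hx ⟨by omega, k.2⟩ ⟨by omega, le_rfl⟩ k.2).trans hxh
  rw [hs₀x (k + 1) (by omega) k.2]
  exact hD.twoTimeRow_zero hαβ hm hmM hnN hhH x h₂ hR h₁' hR' k hk
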